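/- Let $p\in(0,1/2)$, $0\le\tau<1/2$, $0\le R\le 1$. Put $T(x,y)=-x\log_2y-(1-x)\log_2(1-y)$, $h(x)=T(x,x)$, $D(x\|y)=T(x,y)-h(x)$ (with $0\log_2 0=0$), and let $\delta=\delta_{\mathrm{GV}}(R)\in[0,1/2]$ be the solution of $h(\delta)=1-R$ (the relative Gilbert–Varshamov distance). Let $u=p(1-p)$, $\nu=\log_2\frac{1-p}{p}$, $$\rho_0^\pm=\frac{\sqrt{u+\tau^2(1-2p)^2}-p(1\pm2\tau)\pm\tau}{1-2p},\qquad \omega_0=2\,\frac{\sqrt{u+\tau^2(1-4u)}-2u}{1-4u},$$ $$M_\pm=\begin{cases}-\delta\bigl(h(\tfrac12+\tfrac\tau\delta)+\tfrac12\log_2u\bigr)\pm\nu\tau, & R\le 1-h(\omega_0)\quad\text{(a)}\\ D(\rho_0^\pm\|p)+1-R-h(\rho_0^\pm\mp2\tau), & 1-h(\omega_0)<R\le1-h(\rho_0^\pm\mp2\tau)\quad\text{(b)}\\ D(\delta\pm2\tau\|p), & \text{otherwise.}\quad\text{(c)}\end{cases}$$ A binary linear code $C$ of length $n$ and dimension $\lceil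 Rn\rceil$ is used over the binary symmetric channel with crossover probability $p$, with a uniformly distributed transmitted codeword. For $t\ge0$, the decoder $\psi_t$ decodes a received word $y$ to $c\in C$ if $\mathrm d(c',y)-\mathrm d(c,y)\ge 2t$ for all $c'\in C$, $c'\ne c$ ($\mathrm d$ is the Hamming distance), and declares an erasure if there is no such $c$. Let $t=\tau n$. Let $P_e(C)$ be the probability that $y$ may be decoded to a codeword different from the transmitted one (for $t=0$ ties count as errors), and let $P_x(C)$ be the probability of erasure. Let $$E_e(R,p,\tau)=\liminf_{n\to\infty}\sup_C-\tfrac1n\log_2P_e(C),\qquad E_x(R,p,\tau)=\liminf_{n\to\infty}\sup_C-\tfrac1n\log_2P_x(C)$$ be the best attainable exponents ($-\log_2 0=+\infty$). Then: 1. If $R\ge1-h(\frac12-\tau)$ and $\delta+2\tau\ge p$ (the latter holds in particular for all $R$ up to the capacity $1-h(p)$), then $E_e(R,p,\tau)\ge M_+$. 2. If $\tau\le p/2$ and $\delta-2\tau\ge p$ (that is, $p+2\tau\le\frac12$ and $R\le1-h(p+2\tau)$), then $E_x(R,p,\tau)\ge M_-$. 3. Both bounds are attained by the same codes: there is a sequence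 of linear codes $C_n$ of length $n$ and dimension $\lceil Rn\rceil$, meeting the Gilbert–Varshamov bound (for every $\varepsilon>0$ and all large $n$, all nonzero codewords of $C_n$ have weight at least $(\delta-\varepsilon)n$), such that $\liminf_n-\frac1n\log_2P_e(C_n)\ge M_+$ under the hypotheses of 1, and $\liminf_n-\frac1n\log_2P_x(C_n)\ge M_-$ under the hypotheses of 2. 4. These bounds improve on the Blokh–Zyablov bounds. Let $\rho_0=\sqrt p/(\sqrt p+\sqrt{1-p})$, $R_c=1-h(\rho_0)$, $R_e=1-h(2\rho_0(1-\rho_0))$, and let $E_0(R,p)$ be $-\delta\log_2\bigl(2\sqrt{p(1-p)}\bigr)$ for $R\le R_e$, $D(\rho_0\|p)+R_c-R$ for $R_e<R\le R_c$, and $D(\delta\|p)$ for $R>R_c$. Let $B_\pm=E_0(R,p)\pm\nu\tau$ for $R<R_c$ and $B_\pm=E_0(R,p)\pm2\tau\,\frac{\partial}{\partial x}D(x\|p)\big|_{x=\delta}$ for $R\ge R_c$. If $\tau>0$ and $R\le1-h(p)$, then $M_+>B_+$ under the hypotheses of 1, and $M_->B_-$ under the hypotheses of 2. -/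

import Mathlib

open Filter Topology

noncomputable section

namespace ErasureDecoding

/-! ### Entropy functions (base 2) -/

/-- `T(x,y) = -x log₂ y - (1-x) log₂ (1-y)`. -/
def T (x y : ℝ) : ℝ := -x * Real.logb 2 y - (1 - x) * Real.logb 2 (1 - y)

/-- Binary entropy `h(x) = T(x,x)`. -/
def h (x : ℝ) : ℝ := T x x

/-- Binary information divergence `D(x‖y) = T(x,y) - h(x)`. -/
def D (x y : ℝ) : ℝ := T x y - h x

/-- The relative Gilbert–Varshamov distance `h⁻¹(1-R)`, where `h⁻¹` is the inverse of the
bijection `h : [0,1/2] → [0,1]`. -/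
def δGV (R : ℝ) : ℝ := Function.invFunOn h (Set.Icc 0 (1 / 2)) (1 - R)

/-! ### Linear codes, the channel, and the decoder -/

/-- Binary vectors of length `n`, with the Hamming distance `hammingDist`. -/
abbrev Word (n : ℕ) : Type := Fin n → ZMod 2

/-- Binary linear codes of length `n`. -/
abbrev LinearCode (n : ℕ) : Type := Submodule (ZMod 2) (Word n)

/-- The probability that `y` is received when `x` is sent over the binary symmetric channel with
crossover probability `p`. -/
def bscProb {n : ℕ} (p : ℝ) (x y : Word n) : ℝ :=
  p ^ hammingDist x y * (1 - p) ^ (n - hammingDist x y)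

/-- `ψ_t(y) = c`: every other codeword is farther from `y` than `c` by at least `2t`. For `t > 0`
at most one `c` has this property. For `t = 0` this says that `c` is a nearest codeword. -/
def Decodes {n : ℕ} (C : LinearCode n) (t : ℝ) (y c : Word n) : Prop :=
  c ∈ C ∧ ∀ c' ∈ C, c' ≠ c → 2 * t ≤ (hammingDist c' y : ℝ) - (hammingDist c y : ℝ)

/-- The received word `y` may be decoded to a codeword other than the transmitted `c`
(for `t = 0`, ties are counted as errors). -/
def UndetectedError {n : ℕ} (C : LinearCode n) (t : ℝ) (c y : Word n) : Prop :=
  ∃ c', c' ≠ c ∧ Decodes C t y c'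

/-- The decoding result for `y` is undefined. -/
def Erasure {n : ℕ} (C : LinearCode n) (t : ℝ) (y : Word n) : Prop :=
  ∀ c, ¬ Decodes C t y c

open Classical in
/-- Probability of undetected error for a uniformly distributed transmitted codeword. -/
def errorProb {n : ℕ} (C : LinearCode n) (t p : ℝ) : ℝ :=
  (∑ c : C, ∑ y : Word n,
    if UndetectedError C t (c : Word n) y then bscProb p (c : Word n) y else 0) / (Nat.card C : ℝ)

open Classical in
/-- Probability of erasure for a uniformly distributed transmitted codeword. -/
def erasureProb {n : ℕ} (C : LinearCode n) (t p : ℝ) : ℝ :=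
  (∑ c : C, ∑ y : Word n,
    if Erasure C t y then bscProb p (c : Word n) y else 0) / (Nat.card C : ℝ)

open Classical in
/-- `-(1/n) log₂ P`, with value `+∞` at `P = 0`. -/
def exponent (n : ℕ) (P : ℝ) : EReal :=
  if P = 0 then ⊤ else ((-(Real.logb 2 P) / (n : ℝ) : ℝ) : EReal)

/-- Linear codes of length `n` and rate `R`: dimension `⌈Rn⌉`. -/
abbrev CodeOfRate (R : ℝ) (n : ℕ) : Type :=
  {C : LinearCode n // Module.finrank (ZMod 2) C = ⌈R * n⌉₊}

/-- The best attainable exponent `E_e(R,p,τ)` of the probability of undetected error, `t = τn`. -/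
def Ee (R p τ : ℝ) : EReal :=
  liminf (fun n : ℕ => ⨆ C : CodeOfRate R n, exponent n (errorProb C.1 (τ * n) p)) atTop

/-- The best attainable exponent `E_x(R,p,τ)` of the probability of erasure, `t = τn`. -/
def Ex (R p τ : ℝ) : EReal :=
  liminf (fun n : ℕ => ⨆ C : CodeOfRate R n, exponent n (erasureProb C.1 (τ * n) p)) atTop

/-! ### The bounds `M₊`, `M₋`  (`σ = 1` and `σ = -1`) -/

/-- `u = p(1-p)`. -/
def u (p : ℝ) : ℝ := p * (1 - p)

/-- `ν = log₂((1-p)/p)`. -/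
def ν (p : ℝ) : ℝ := Real.logb 2 ((1 - p) / p)

/-- `ρ₀^σ`. -/
def ρ₀ (σ p τ : ℝ) : ℝ :=
  (√(u p + τ ^ 2 * (1 - 2 * p) ^ 2) - p * (1 + σ * (2 * τ)) + σ * τ) / (1 - 2 * p)

/-- `ω₀`. -/
def ω₀ (p τ : ℝ) : ℝ :=
  2 * ((√(u p + τ ^ 2 * (1 - 4 * u p)) - 2 * u p) / (1 - 4 * u p))

open Classical in
/-- The three-piece function with sign `σ = ±1`. -/
def M (σ R p τ : ℝ) : ℝ :=
  if R ≤ 1 - h (ω₀ p τ) then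
    -(δGV R) * (h (1 / 2 + τ / δGV R) + 1 / 2 * Real.logb 2 (u p)) + σ * (ν p * τ)
  else if R ≤ 1 - h (ρ₀ σ p τ - σ * (2 * τ)) then
    D (ρ₀ σ p τ) p + 1 - R - h (ρ₀ σ p τ - σ * (2 * τ))
  else
    D (δGV R + σ * (2 * τ)) p

/-- `M₊`. -/
def Mplus (R p τ : ℝ) : ℝ := M 1 R p τ

/-- `M₋`. -/
def Mminus (R p τ : ℝ) : ℝ := M (-1) R p τ

/-! ### The Gallager exponent and the Blokh–Zyablov bounds -/

/-- `ρ₀ = √p / (√p + √(1-p))`. -/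
def ρcrit (p : ℝ) : ℝ := √p / (√p + √(1 - p))

/-- The critical rate `R_c = 1 - h(ρ₀)`. -/
def Rc (p : ℝ) : ℝ := 1 - h (ρcrit p)

/-- The expurgation rate `R_e = 1 - h(2ρ₀(1-ρ₀))`. -/
def Re (p : ℝ) : ℝ := 1 - h (2 * ρcrit p * (1 - ρcrit p))

open Classical in
/-- The Gallager bound `E_0(R,p)`. -/
def E0 (R p : ℝ) : ℝ :=
  if R ≤ Re p then -(δGV R) * Real.logb 2 (2 * √(p * (1 - p)))
  else if R ≤ Rc p then D (ρcrit p) p + Rc p - R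
  else D (δGV R) p

open Classical in
/-- The Blokh–Zyablov bounds on `E_e` (`σ = 1`) and `E_x` (`σ = -1`). -/
def BZ (σ R p τ : ℝ) : ℝ :=
  if R < Rc p then E0 R p + σ * (ν p * τ)
  else E0 R p + σ * (2 * τ * deriv (fun δ => D δ p) (δGV R))

end ErasureDecoding

end

/-!
Everything rests on one kind of code and one kind of bound.

*Codes.* Adding one well-chosen generator at a time, and averaging over the choices, gives for each
length a linear code whose number of codewords of weight `w` is at most `n 2^(k-n)` times the
binomial coefficient (`exists_code_spectrum`). Where that bound is below one there are no codewords
at all, so these codes meet the Gilbert–Varshamov bound (`GoodSpectrum.weight_ge`).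

*Channel.* By linearity send `0`. An error (sign `σ = 1`) or an erasure (`σ = -1`) forces a nonzero
codeword `c` with `|y| - |y - c| ≥ 2σt`; the probability of this is `confusionProb`, and from here
on only the signed threshold `σt` matters. The event is bounded with tilting parameters
`z, y, v ≥ 1`, which pay for the margin `|y| - |y - c|`, for the minimum weight of the code and for
an upper limit on the weight of the received word. The sum over pairs (received word, codeword)
then factors over coordinates (`sum_pair`), and the bound has the exponent `chernoffExponent`
(`GoodSpectrum.hasExponent_chernoff`). The binomial theorem replaces asymptotics of binomial coefficients. Received
words above the weight limit are left to the binomial tail.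

*Duality.* `chernoffExponent` is the dual of minimizing `typeExponent` over joint types of received
word and codeword. The two agree when the tilted weights of the four cells are proportional to the
type (`chernoffExponent_eq`). The three pieces of `M` come from three families of types: conditional
types, where the noise is biased on the support of a codeword of weight `δn`; independent types,
where the received word is independent of its difference with the codeword, with no constraint
active; and independent types at the weight limit `(δ + 2στ)n`. The case distinctions in `M` say
exactly that the corresponding tilting parameters are at least one (`M_cases`,
`GoodSpectrum.hasExponent_M`).

*Comparison.* The Blokh–Zyablov bound is `chernoffExponent` at the tilting parameters that are
optimal for `τ = 0` (`exists_chernoffExponent_eq_BZ`), that is, the tangent in `τ`. Hence it is at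
most `M` by weak duality. The inequality is strict because those parameters give equal weights to
the cells `(0,1)` and `(1,1)`, whereas the frequencies of these cells in the type behind `M` differ
by `2στ` (`BZ_lt_M`).
-/

open Filter Topology

namespace ErasureDecoding

/-! ### Linear codes with a random-like weight spectrum -/

open Classical in
/-- Some code of each dimension has at most the average sum of `f`. A random linear code is avoided:
the code grows by one generator at a time, and the ratio `(2^k - 1)/(2^n - 1)` is just the one that
averaging over the next generator preserves. -/
lemma exists_code_sum_le {n : ℕ} (f : Word n → ℝ) (hf0 : f 0 = 0) (hf : ∀ x, 0 ≤ f x) :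
    ∀ k ≤ n, ∃ C : LinearCode n, Module.finrank (ZMod 2) C = k ∧
      (2 ^ n - 1) * ∑ x with x ∈ C, f x ≤ (2 ^ k - 1) * ∑ x, f x := by
  intro k
  induction k with
  | zero =>
    intro _
    refine ⟨⊥, by simp, ?_⟩
    have : ∑ x with x ∈ (⊥ : LinearCode n), f x = 0 :=
      Finset.sum_eq_zero fun x hx => by
        have : x = 0 := by simpa using hx
        rw [this, hf0]
    rw [this]
    simp
  | succ k ih =>
    intro hk
    obtain ⟨C, hC, hF⟩ := ih (by omega)
    set F := ∑ x with x ∈ C, f x with hFdef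
    set S := ∑ x, f x with hSdef
    have hS : 0 ≤ S := Finset.sum_nonneg fun x _ => hf x
    have hsplit : F + ∑ x with x ∉ C, f x = S := Finset.sum_filter_add_sum_filter_not _ _ _
    have hcardC : (Finset.univ.filter (· ∈ C)).card = 2 ^ k := by
      have h1 := Module.card_eq_pow_finrank (K := ZMod 2) (V := C)
      rw [hC, ZMod.card] at h1
      rw [← h1, Fintype.card_subtype]
    have hcardN : (Finset.univ.filter (· ∉ C)).card + 2 ^ k = 2 ^ n := by
      rw [← hcardC, add_comm, Finset.card_filter_add_card_filter_not]
      simp [ZMod.card]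
    have h2m : 2 * 2 ^ k ≤ (2 : ℝ) ^ n := by
      rw [← pow_succ']
      exact pow_le_pow_right₀ (by norm_num) hk
    have hm : (1 : ℝ) ≤ 2 ^ k := one_le_pow₀ (by norm_num)
    have hcardN' : ((Finset.univ.filter (· ∉ C)).card : ℝ) = 2 ^ n - 2 ^ k := by
      rw [eq_sub_iff_add_eq]; exact_mod_cast hcardN
    -- summed over all `x ∉ C`, the cosets `x + C` cover the complement of `C` exactly `|C|` times
    have hsum : ∑ x with x ∉ C, ∑ c with c ∈ C, f (x + c) = 2 ^ k * (S - F) := by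
      rw [Finset.sum_comm]
      have : ∀ c ∈ Finset.univ.filter (· ∈ C), ∑ x with x ∉ C, f (x + c) = S - F := by
        intro c hc
        rw [← hsplit, add_sub_cancel_left]
        have hc' : c ∈ C := by simpa using hc
        refine Finset.sum_bij' (fun x _ => x + c) (fun x _ => x - c) ?_ ?_ ?_ ?_ ?_
        · intro x hx; simpa [C.add_mem_iff_left hc'] using hx
        · intro x hx; simpa [C.sub_mem_iff_left hc'] using hx
        · intro x _; simp
        · intro x _; simp
        · intro x _; rfl
      rw [Finset.sum_congr rfl this, Finset.sum_const, hcardC, nsmul_eq_mul]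
      push_cast; ring
    have hpos : (0 : ℝ) < 2 ^ n - 2 ^ k := by linarith
    have hne : (Finset.univ.filter (· ∉ C)).Nonempty := by
      rw [← Finset.card_pos, ← Nat.cast_pos (α := ℝ), hcardN']; exact hpos
    obtain ⟨x, hx, hxle⟩ := Finset.exists_le_of_sum_le
      (s := Finset.univ.filter (· ∉ C)) hne (f := fun x => ∑ c with c ∈ C, f (x + c))
      (g := fun _ => 2 ^ k * (S - F) / (2 ^ n - 2 ^ k)) (by
        rw [hsum, Finset.sum_const, nsmul_eq_mul, hcardN', mul_div_cancel₀ _ hpos.ne'])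
    have hx' : x ∉ C := by simpa using hx
    refine ⟨C ⊔ Submodule.span (ZMod 2) {x}, by rw [Submodule.finrank_sup_span_singleton hx', hC], ?_⟩
    have hmem : ∀ y, y ∈ C ⊔ Submodule.span (ZMod 2) {x} ↔ y ∈ C ∨ y - x ∈ C := by
      intro y
      rw [Submodule.mem_sup]
      constructor
      · rintro ⟨c, hc, z, hz, rfl⟩
        obtain ⟨a, rfl⟩ := Submodule.mem_span_singleton.1 hz
        have ha : a = 0 ∨ a = 1 := (by decide : ∀ a : ZMod 2, a = 0 ∨ a = 1) a
        rcases ha with rfl | rfl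
        · left; simpa using hc
        · right; simpa using hc
      · rintro (hy | hy)
        · exact ⟨y, hy, 0, Submodule.zero_mem _, add_zero _⟩
        · exact ⟨y - x, hy, x, Submodule.mem_span_singleton_self x, sub_add_cancel _ _⟩
    have hF' : ∑ y with y ∈ C ⊔ Submodule.span (ZMod 2) {x}, f y
        = F + ∑ c with c ∈ C, f (x + c) := by
      have hdisj : Disjoint (Finset.univ.filter (· ∈ C)) (Finset.univ.filter (· - x ∈ C)) := by
        rw [Finset.disjoint_filter]
        intro y _ hy hy'
        exact hx' (by simpa using C.sub_mem hy hy')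
      simp_rw [hmem]
      rw [Finset.filter_or, Finset.sum_union hdisj]
      congr 1
      refine Finset.sum_bij' (fun y _ => y - x) (fun c _ => x + c) ?_ ?_ ?_ ?_ ?_
      · intro y hy; simpa using hy
      · intro y hy; simpa using hy
      · intro y _; simp
      · intro y _; simp
      · intro y _; simp
    rw [hF']
    set G := ∑ c with c ∈ C, f (x + c)
    rw [le_div_iff₀ hpos] at hxle
    refine le_of_mul_le_mul_left ?_ hpos
    have h1 := mul_le_mul_of_nonneg_left hF (sub_nonneg.2 h2m)
    have h2 := mul_le_mul_of_nonneg_left hxle (by linarith : (0 : ℝ) ≤ 2 ^ n - 1)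
    rw [pow_succ]
    nlinarith [h1, h2]

lemma sum_word_hammingNorm {n : ℕ} (f : ℕ → ℝ) :
    ∑ x : Word n, f (hammingNorm x) = ∑ w ∈ Finset.range (n + 1), (n.choose w : ℝ) * f w := by
  classical
  have h1 := Finset.sum_powerset_apply_card (α := ℝ) f (x := (Finset.univ : Finset (Fin n)))
  simp only [Finset.card_univ, Fintype.card_fin, nsmul_eq_mul] at h1
  rw [← h1]
  refine Finset.sum_bij' (fun x _ => Finset.univ.filter (fun i => x i ≠ 0))
    (fun s _ i => if i ∈ s then 1 else 0) ?_ ?_ ?_ ?_ ?_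
  · simp
  · simp
  · intro x _
    funext i
    have : ∀ a : ZMod 2, (if a ≠ 0 then 1 else 0) = a := by decide
    simpa using this (x i)
  · intro s _
    ext i
    simp
  · intro x _; rfl

open Classical in
/-- A linear code of prescribed dimension with a binomial-like weight spectrum. As all terms are
nonnegative, the sum bounds the number of codewords of each weight `w > 0` by `n 2^(k-n)` times the
binomial coefficient; kept as a sum, it bounds sums over codewords directly. -/
lemma exists_code_spectrum {n k : ℕ} (hk : k ≤ n) :
    ∃ C : LinearCode n, Module.finrank (ZMod 2) C = k ∧
      ∑ c with c ∈ C ∧ c ≠ 0, ((n.choose (hammingNorm c) : ℝ))⁻¹ ≤ n * (2 ^ k / 2 ^ n) := by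
  obtain ⟨C, hC, h⟩ := exists_code_sum_le (n := n)
    (fun x => if hammingNorm x = 0 then 0 else ((n.choose (hammingNorm x) : ℝ))⁻¹) (by simp)
    (fun x => by split_ifs <;> positivity) k hk
  refine ⟨C, hC, ?_⟩
  rw [sum_word_hammingNorm (fun w => if w = 0 then 0 else ((n.choose w : ℝ))⁻¹)] at h
  have hS : ∑ w ∈ Finset.range (n + 1), (n.choose w : ℝ) *
      (if w = 0 then 0 else ((n.choose w : ℝ))⁻¹) = n := by
    rw [Finset.sum_range_succ']
    simp only [Nat.add_eq_zero_iff, one_ne_zero, and_false, if_false, if_true, mul_zero, add_zero]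
    rw [Finset.sum_congr rfl (g := fun _ => (1 : ℝ))]
    · simp
    · intro w hw
      refine mul_inv_cancel₀ ?_
      have := Nat.choose_pos (Finset.mem_range.1 hw : w + 1 ≤ n)
      positivity
  rw [hS] at h
  have hF : ∑ c with c ∈ C ∧ c ≠ 0, ((n.choose (hammingNorm c) : ℝ))⁻¹ =
      ∑ x with x ∈ C, (if hammingNorm x = 0 then 0 else ((n.choose (hammingNorm x) : ℝ))⁻¹) := by
    rw [← Finset.filter_filter, Finset.sum_filter]
    refine Finset.sum_congr rfl fun x _ => ?_
    by_cases hx : x = 0 <;> simp [hx]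
  rw [hF]
  rcases Nat.eq_zero_or_pos n with rfl | hn
  · simp only [CharP.cast_eq_zero, zero_mul]
    refine le_of_eq (Finset.sum_eq_zero fun x _ => ?_)
    have : x = 0 := Subsingleton.elim _ _
    simp [this]
  have h2n : (1 : ℝ) < 2 ^ n := one_lt_pow₀ (by norm_num) hn.ne'
  have hkn : (2 : ℝ) ^ k ≤ 2 ^ n := pow_le_pow_right₀ (by norm_num) hk
  have h3 : ((2 : ℝ) ^ k - 1) / (2 ^ n - 1) ≤ 2 ^ k / 2 ^ n := by
    rw [div_le_div_iff₀ (by linarith) (by linarith)]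
    nlinarith
  calc _ ≤ (2 ^ k - 1) * (n : ℝ) / (2 ^ n - 1) := by
        rw [le_div_iff₀ (by linarith)]; linarith
    _ = n * ((2 ^ k - 1) / (2 ^ n - 1)) := by ring
    _ ≤ _ := mul_le_mul_of_nonneg_left h3 (by positivity)

lemma choose_mul_pow_le {n w : ℕ} {a b : ℝ} (ha : 0 ≤ a) (hb : 0 ≤ b) (hw : w ≤ n) :
    (n.choose w : ℝ) * (a ^ (n - w) * b ^ w) ≤ (a + b) ^ n := by
  rw [add_comm a b, add_pow]
  refine le_trans (le_of_eq ?_) (Finset.single_le_sum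
    (f := fun m => b ^ m * a ^ (n - m) * (n.choose m : ℝ)) (fun i _ => by positivity)
    (Finset.mem_range.2 (Nat.lt_succ_of_le hw)))
  ring

lemma hammingNorm_le {n : ℕ} (x : Word n) : hammingNorm x ≤ n := by
  simpa using hammingNorm_le_card_fintype (x := x)

open Classical in
lemma sum_code_le {n : ℕ} (C : LinearCode n) {a b A : ℝ} (ha : 0 ≤ a) (hb : 0 ≤ b)
    (hA : ∑ c with c ∈ C ∧ c ≠ 0, ((n.choose (hammingNorm c) : ℝ))⁻¹ ≤ A) :
    ∑ c with c ∈ C ∧ c ≠ 0, a ^ (n - hammingNorm c) * b ^ hammingNorm c ≤ A * (a + b) ^ n := by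
  refine le_trans ?_ (mul_le_mul_of_nonneg_right hA (by positivity))
  rw [Finset.sum_mul]
  refine Finset.sum_le_sum fun c _ => ?_
  have hpos : (0 : ℝ) < n.choose (hammingNorm c) := by
    exact_mod_cast Nat.choose_pos (hammingNorm_le c)
  rw [inv_mul_eq_div, le_div_iff₀ hpos, mul_comm]
  exact choose_mul_pow_le ha hb (hammingNorm_le c)

open Classical in
/-- In a code with minimum weight at least `L` a factor `y^(|c| - L) ≥ 1` may be inserted. -/
lemma sum_code_le_of_weight {n : ℕ} (C : LinearCode n) {a b A y L : ℝ} (ha : 0 ≤ a) (hb : 0 ≤ b)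
    (hy : 1 ≤ y) (hA : ∑ c with c ∈ C ∧ c ≠ 0, ((n.choose (hammingNorm c) : ℝ))⁻¹ ≤ A)
    (hL : ∀ c ∈ C, c ≠ 0 → L ≤ hammingNorm c) :
    ∑ c with c ∈ C ∧ c ≠ 0, a ^ (n - hammingNorm c) * b ^ hammingNorm c
      ≤ y ^ (-L) * (A * (a + y * b) ^ n) := by
  have hy0 : 0 < y := by linarith
  refine le_trans ?_ (mul_le_mul_of_nonneg_left
    (sum_code_le C ha (mul_nonneg hy0.le hb) hA) (by positivity))
  rw [Finset.mul_sum]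
  refine Finset.sum_le_sum fun c hc => ?_
  simp only [Finset.mem_filter, Finset.mem_univ, true_and] at hc
  have h1 : 1 ≤ y ^ (-L) * y ^ hammingNorm c := by
    rw [← Real.rpow_natCast y, ← Real.rpow_add hy0]
    exact Real.one_le_rpow hy (by linarith [hL c hc.1 hc.2])
  calc _ ≤ (y ^ (-L) * y ^ hammingNorm c) *
        (a ^ (n - hammingNorm c) * b ^ hammingNorm c) :=
        le_mul_of_one_le_left (by positivity) h1
    _ = _ := by rw [mul_pow]; ring

/-! ### Chernoff bounds over the binary symmetric channel -/

lemma bscProb_zero {n : ℕ} (p : ℝ) (y : Word n) :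
    bscProb p 0 y = p ^ hammingNorm y * (1 - p) ^ (n - hammingNorm y) := by
  simp [bscProb]

lemma bscProb_nonneg {n : ℕ} {p : ℝ} (hp0 : 0 ≤ p) (hp1 : p ≤ 1) (x y : Word n) :
    0 ≤ bscProb p x y :=
  mul_nonneg (pow_nonneg hp0 _) (pow_nonneg (sub_nonneg.2 hp1) _)

open Classical in
/-- The probability, when `0` is sent, that some nonzero codeword is closer to the received word
than `0` by at least `a` (which may be negative). -/
noncomputable def confusionProb {n : ℕ} (C : LinearCode n) (a p : ℝ) : ℝ :=
  ∑ y : Word n with ∃ c ∈ C, c ≠ 0 ∧ a ≤ (hammingNorm y : ℝ) - hammingNorm (y - c), bscProb p 0 y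

open Classical in
/-- By linearity every transmitted codeword may be translated to `0`; `E c y` is the failure event
when `c` is sent and `y` received. -/
lemma average_le_confusionProb {n : ℕ} (C : LinearCode n) {a p : ℝ} (hp0 : 0 ≤ p) (hp1 : p ≤ 1)
    (E : Word n → Word n → Prop)
    (hE : ∀ c ∈ C, ∀ y, E c y →
      ∃ c' ∈ C, c' ≠ c ∧ a ≤ (hammingDist c y : ℝ) - hammingDist c' y) :
    (∑ c : C, ∑ y : Word n, if E c y then bscProb p (c : Word n) y else 0) / (Nat.card C : ℝ)
      ≤ confusionProb C a p := by
  have key : ∀ c : C, (∑ y : Word n, if E c y then bscProb p (c : Word n) y else 0)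
      ≤ confusionProb C a p := by
    intro c
    have hsum : (∑ y : Word n, if E c y then bscProb p (c : Word n) y else 0) =
        ∑ y : Word n, if E c (y + c) then bscProb p (c : Word n) (y + c) else 0 :=
      (Equiv.sum_comp (Equiv.addRight (c : Word n))
        (fun y => if E c y then bscProb p (c : Word n) y else 0)).symm
    rw [confusionProb, Finset.sum_filter, hsum]
    refine Finset.sum_le_sum fun y _ => ?_
    have hb : bscProb p (c : Word n) (y + c) = bscProb p 0 y := by
      simp [bscProb, hammingDist_eq_hammingNorm]
    rw [hb]
    by_cases h : E c (y + c)
    · obtain ⟨c', hc', hne, hle⟩ := hE c c.2 _ h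
      rw [if_pos h, if_pos]
      refine ⟨c' - c, C.sub_mem hc' c.2, sub_ne_zero.2 hne, ?_⟩
      have e1 : hammingDist (c : Word n) (y + c) = hammingNorm y := by
        rw [hammingDist_eq_hammingNorm]; congr 1; abel
      have e2 : hammingDist c' (y + c) = hammingNorm (y - (c' - (c : Word n))) := by
        rw [hammingDist_eq_hammingNorm]; congr 1; abel
      rwa [e1, e2] at hle
    · rw [if_neg h]
      split_ifs
      · exact bscProb_nonneg hp0 hp1 _ _
      · exact le_rfl
  have hcard : (0 : ℝ) < Nat.card C := by exact_mod_cast Nat.card_pos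
  rw [div_le_iff₀ hcard]
  refine (Finset.sum_le_sum fun c _ => key c).trans (le_of_eq ?_)
  rw [Finset.sum_const, nsmul_eq_mul, Nat.card_eq_fintype_card, Finset.card_univ, mul_comm]

lemma errorProb_le_confusionProb {n : ℕ} (C : LinearCode n) {t p : ℝ} (hp0 : 0 ≤ p)
    (hp1 : p ≤ 1) : errorProb C t p ≤ confusionProb C (2 * t) p := by
  refine average_le_confusionProb C hp0 hp1 (UndetectedError C t) ?_
  rintro c hc y ⟨c', hne, hc', h⟩
  exact ⟨c', hc', hne, h c hc hne.symm⟩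

lemma erasureProb_le_confusionProb {n : ℕ} (C : LinearCode n) {t p : ℝ} (hp0 : 0 ≤ p)
    (hp1 : p ≤ 1) : erasureProb C t p ≤ confusionProb C (-(2 * t)) p := by
  refine average_le_confusionProb C hp0 hp1 (fun _ y => Erasure C t y) ?_
  intro c hc y h
  have h' := h c
  simp only [Decodes, hc, true_and, not_forall, not_le] at h'
  obtain ⟨c', hc', hne, hlt⟩ := h'
  exact ⟨c', hc', hne, by linarith⟩

lemma errorProb_nonneg {n : ℕ} (C : LinearCode n) {t p : ℝ} (hp0 : 0 ≤ p)
    (hp1 : p ≤ 1) : 0 ≤ errorProb C t p := by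
  refine div_nonneg (Finset.sum_nonneg fun c _ => Finset.sum_nonneg fun y _ => ?_) (by positivity)
  split_ifs
  exacts [bscProb_nonneg hp0 hp1 _ _, le_rfl]

lemma erasureProb_nonneg {n : ℕ} (C : LinearCode n) {t p : ℝ} (hp0 : 0 ≤ p)
    (hp1 : p ≤ 1) : 0 ≤ erasureProb C t p := by
  refine div_nonneg (Finset.sum_nonneg fun c _ => Finset.sum_nonneg fun y _ => ?_) (by positivity)
  split_ifs
  exacts [bscProb_nonneg hp0 hp1 _ _, le_rfl]

lemma prod_ite_eq_zero {n : ℕ} (a b : ℝ) (x : Word n) :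
    ∏ i, (if x i = 0 then a else b) = a ^ (n - hammingNorm x) * b ^ hammingNorm x := by
  rw [Finset.prod_ite, Finset.prod_const, Finset.prod_const]
  have h := Finset.card_filter_add_card_filter_not (s := (Finset.univ : Finset (Fin n)))
    (fun i => x i = 0)
  rw [Finset.card_univ, Fintype.card_fin] at h
  have h2 : hammingNorm x = (Finset.univ.filter (fun i => ¬ x i = 0)).card := rfl
  rw [h2]
  congr 2
  omega

lemma sum_zmod_two (f : ZMod 2 → ℝ) : ∑ j, f j = f 0 + f 1 := Fin.sum_univ_two f

lemma sum_pow_hammingNorm {n : ℕ} (a b : ℝ) :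
    ∑ y : Word n, a ^ (n - hammingNorm y) * b ^ hammingNorm y = (a + b) ^ n := by
  simp_rw [← prod_ite_eq_zero]
  rw [← Fintype.prod_sum (fun (_ : Fin n) (j : ZMod 2) => if j = 0 then a else b),
    Finset.prod_congr rfl (g := fun _ => a + b), Finset.prod_const, Finset.card_univ,
    Fintype.card_fin]
  intro i _
  simp [sum_zmod_two]

/-- The sum over received words factors over coordinates; a coordinate off the support of `c`
contributes `a + b` because there `y` and `y - c` agree and the factors `z`, `z'` cancel. -/
lemma sum_pair {n : ℕ} (a b z z' : ℝ) (c : Word n) (hz : z * z' = 1) :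
    ∑ y : Word n, a ^ (n - hammingNorm y) * b ^ hammingNorm y *
        (z ^ hammingNorm y * z' ^ hammingNorm (y - c))
      = (a + b) ^ (n - hammingNorm c) * (a * z' + b * z) ^ hammingNorm c := by
  have h1 : ∀ y : Word n, a ^ (n - hammingNorm y) * b ^ hammingNorm y *
      (z ^ hammingNorm y * z' ^ hammingNorm (y - c)) =
      ∏ i, (if y i = 0 then a else b) * ((if y i = 0 then 1 else z) *
        (if y i - c i = 0 then 1 else z')) := by
    intro y
    rw [Finset.prod_mul_distrib, Finset.prod_mul_distrib, prod_ite_eq_zero, prod_ite_eq_zero]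
    have := prod_ite_eq_zero 1 z' (y - c)
    simp only [Pi.sub_apply] at this
    rw [this, one_pow, one_pow, one_mul, one_mul]
  simp_rw [h1]
  rw [← Fintype.prod_sum (fun (i : Fin n) (j : ZMod 2) => (if j = 0 then a else b) *
    ((if j = 0 then 1 else z) * (if j - c i = 0 then 1 else z'))), ← prod_ite_eq_zero]
  refine Finset.prod_congr rfl fun i _ => ?_
  rw [sum_zmod_two]
  have hc : c i = 0 ∨ c i = 1 := (by decide : ∀ a : ZMod 2, a = 0 ∨ a = 1) (c i)
  rcases hc with hc | hc
  · simp [hc, hz]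
  · simp [hc]

lemma sum_bscProb_tail_le {n : ℕ} {p L v : ℝ} (hp0 : 0 ≤ p) (hp1 : p ≤ 1) (hv : 1 ≤ v) :
    ∑ y : Word n with L ≤ hammingNorm y, bscProb p 0 y ≤ v ^ (-L) * ((1 - p) + p * v) ^ n := by
  have hv0 : 0 < v := by linarith
  rw [← sum_pow_hammingNorm, Finset.mul_sum, Finset.sum_filter]
  refine Finset.sum_le_sum fun y _ => ?_
  have hq : 0 ≤ 1 - p := by linarith
  split_ifs with h
  · have h1 : 1 ≤ v ^ (-L) * v ^ hammingNorm y := by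
      rw [← Real.rpow_natCast v, ← Real.rpow_add hv0]
      exact Real.one_le_rpow hv (by linarith)
    calc _ ≤ (v ^ (-L) * v ^ hammingNorm y) * bscProb p 0 y :=
          le_mul_of_one_le_left (bscProb_nonneg hp0 hp1 _ _) h1
      _ = _ := by rw [bscProb_zero, mul_pow]; ring
  · positivity

open Classical in
/-- Chernoff form of the union bound over codewords, for received words of weight at most `L`
(of any weight when `v = 1`). -/
lemma sum_confusion_le {n : ℕ} (C : LinearCode n) {a p L v z : ℝ} (hp0 : 0 ≤ p) (hp1 : p ≤ 1)
    (hv : 1 ≤ v) (hz : 1 ≤ z) (P : Word n → Prop) (hP : ∀ y, P y → v = 1 ∨ hammingNorm y ≤ L) :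
    ∑ y : Word n with (∃ c ∈ C, c ≠ 0 ∧ a ≤ (hammingNorm y : ℝ) - hammingNorm (y - c)) ∧ P y,
        bscProb p 0 y
      ≤ v ^ L * z ^ (-a) * ∑ c with c ∈ C ∧ c ≠ 0, ((1 - p) + p / v) ^ (n - hammingNorm c) *
          ((1 - p) * z⁻¹ + p / v * z) ^ hammingNorm c := by
  have hv0 : 0 < v := by linarith
  have hz0 : 0 < z := by linarith
  have hq : 0 ≤ 1 - p := by linarith
  simp_rw [← sum_pair (1 - p) (p / v) z z⁻¹ _ (mul_inv_cancel₀ hz0.ne')]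
  rw [Finset.sum_comm, Finset.mul_sum, Finset.sum_filter]
  refine Finset.sum_le_sum fun y _ => ?_
  split_ifs with h
  · obtain ⟨⟨c, hc, hc0, hle⟩, hPy⟩ := h
    refine le_trans ?_ (mul_le_mul_of_nonneg_left (Finset.single_le_sum
      (f := fun c => (1 - p) ^ (n - hammingNorm y) * (p / v) ^ hammingNorm y *
        (z ^ hammingNorm y * z⁻¹ ^ hammingNorm (y - c))) (fun i _ => by positivity)
      (show c ∈ Finset.univ.filter (fun c => c ∈ C ∧ c ≠ 0) by simp [hc, hc0])) (by positivity))
    have h1 : 1 ≤ v ^ L / v ^ hammingNorm y := by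
      rcases hP y hPy with rfl | hL
      · simp
      · rw [← Real.rpow_natCast v, ← Real.rpow_sub hv0]
        exact Real.one_le_rpow hv (by linarith)
    have h2 : 1 ≤ z ^ (-a) * (z ^ hammingNorm y * z⁻¹ ^ hammingNorm (y - c)) := by
      rw [inv_pow, ← Real.rpow_natCast z, ← Real.rpow_natCast z, ← Real.rpow_neg hz0.le,
        ← Real.rpow_add hz0, ← Real.rpow_add hz0]
      exact Real.one_le_rpow hz (by linarith)
    calc bscProb p 0 y ≤ ((v ^ L / v ^ hammingNorm y) *
          (z ^ (-a) * (z ^ hammingNorm y * z⁻¹ ^ hammingNorm (y - c)))) * bscProb p 0 y :=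
          le_mul_of_one_le_left (bscProb_nonneg hp0 hp1 _ _) (one_le_mul_of_one_le_of_one_le h1 h2)
      _ = _ := by rw [bscProb_zero, div_pow]; ring
  · exact mul_nonneg (by positivity) (Finset.sum_nonneg fun c _ => by positivity)

open Classical in
/-- The case without a weight limit. The trivial factor `1 ^ _` is the weight off the support. -/
lemma confusionProb_le {n : ℕ} (C : LinearCode n) {a p z : ℝ} (hp0 : 0 ≤ p) (hp1 : p ≤ 1)
    (hz : 1 ≤ z) :
    confusionProb C a p ≤ z ^ (-a) * ∑ c with c ∈ C ∧ c ≠ 0,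
      1 ^ (n - hammingNorm c) * ((1 - p) * z⁻¹ + p * z) ^ hammingNorm c := by
  have := sum_confusion_le C (a := a) (L := 0) hp0 hp1 le_rfl hz (fun _ => True)
    (fun _ _ => Or.inl rfl)
  simpa [confusionProb] using this

open Classical in
/-- Being closer to `c` by `a` requires weight at least `a`. -/
lemma confusionProb_le_tail {n : ℕ} (C : LinearCode n) {a p L v : ℝ} (hp0 : 0 ≤ p) (hp1 : p ≤ 1)
    (hv : 1 ≤ v) (haL : L ≤ a) :
    confusionProb C a p ≤ v ^ (-L) * ((1 - p) + p * v) ^ n := by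
  refine le_trans ?_ (sum_bscProb_tail_le hp0 hp1 hv)
  refine Finset.sum_le_sum_of_subset_of_nonneg ?_ fun y _ _ => bscProb_nonneg hp0 hp1 _ _
  intro y
  simp only [Finset.mem_filter, Finset.mem_univ, true_and]
  rintro ⟨c, -, -, h⟩
  have : (0 : ℝ) ≤ hammingNorm (y - c) := by positivity
  linarith

open Classical in
/-- Received words of weight at least `L` are left to the binomial tail, lighter ones to the union
bound over codewords. -/
lemma confusionProb_le_tail_add {n : ℕ} (C : LinearCode n) {a p L v v' z : ℝ} (hp0 : 0 ≤ p)
    (hp1 : p ≤ 1) (hv : 1 ≤ v) (hv' : 1 ≤ v') (hz : 1 ≤ z) :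
    confusionProb C a p ≤ v' ^ (-L) * ((1 - p) + p * v') ^ n +
      v ^ L * z ^ (-a) * ∑ c with c ∈ C ∧ c ≠ 0, ((1 - p) + p / v) ^ (n - hammingNorm c) *
          ((1 - p) * z⁻¹ + p / v * z) ^ hammingNorm c := by
  refine le_trans ?_ (add_le_add (sum_bscProb_tail_le hp0 hp1 hv')
    (sum_confusion_le C (a := a) (L := L) hp0 hp1 hv hz (fun y => hammingNorm y ≤ L)
      (fun _ h => Or.inr h)))
  rw [confusionProb, Finset.sum_filter, Finset.sum_filter, Finset.sum_filter,
    ← Finset.sum_add_distrib]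
  refine Finset.sum_le_sum fun y _ => ?_
  have hb := bscProb_nonneg hp0 hp1 0 y
  by_cases h1 : L ≤ hammingNorm y
  · rw [if_pos h1]
    split_ifs <;> linarith
  · rw [if_neg h1]
    simp only [(not_le.1 h1).le, and_true, zero_add, le_refl]

/-! ### Binary entropy and the Gilbert–Varshamov distance -/

lemma h_eq_binEntropy (x : ℝ) : h x = Real.binEntropy x / Real.log 2 := by
  simp only [h, T, Real.binEntropy, Real.logb, Real.log_inv]
  ring

lemma h_one_sub (x : ℝ) : h (1 - x) = h x := by
  rw [h_eq_binEntropy, h_eq_binEntropy, Real.binEntropy_one_sub]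

lemma h_strictMonoOn : StrictMonoOn h (Set.Icc 0 (1 / 2)) := by
  intro x hx y hy hxy
  rw [h_eq_binEntropy, h_eq_binEntropy]
  rw [one_div] at hx hy
  exact div_lt_div_of_pos_right (Real.binEntropy_strictMonoOn hx hy hxy)
    (Real.log_pos one_lt_two)

lemma h_zero : h 0 = 0 := by simp [h_eq_binEntropy]

lemma h_half : h (1 / 2) = 1 := by
  rw [h_eq_binEntropy, one_div, Real.binEntropy_two_inv,
    div_self (Real.log_pos one_lt_two).ne']

lemma exists_h_eq {R : ℝ} (hR0 : 0 ≤ R) (hR1 : R ≤ 1) :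
    ∃ x ∈ Set.Icc (0 : ℝ) (1 / 2), h x = 1 - R := by
  have hcont : ContinuousOn h (Set.Icc 0 (1 / 2)) := by
    have : h = fun x => Real.binEntropy x / Real.log 2 := funext h_eq_binEntropy
    rw [this]
    exact (Real.binEntropy_continuous.div_const _).continuousOn
  have := intermediate_value_Icc (by norm_num) hcont
  rw [h_zero, h_half] at this
  exact this ⟨by linarith, by linarith⟩

lemma δGV_mem {R : ℝ} (hR0 : 0 ≤ R) (hR1 : R ≤ 1) : δGV R ∈ Set.Icc (0 : ℝ) (1 / 2) :=
  Function.invFunOn_mem (exists_h_eq hR0 hR1)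

lemma h_δGV {R : ℝ} (hR0 : 0 ≤ R) (hR1 : R ≤ 1) : h (δGV R) = 1 - R :=
  Function.invFunOn_eq (exists_h_eq hR0 hR1)

lemma h_le_iff {x y : ℝ} (hx : x ∈ Set.Icc (0 : ℝ) (1 / 2)) (hy : y ∈ Set.Icc (0 : ℝ) (1 / 2)) :
    h x ≤ h y ↔ x ≤ y := h_strictMonoOn.le_iff_le hx hy

/-! ### Exponential decay rates -/

/-- `P n ≤ 2^(-n (M - o(1)))`: the sequence `P` decays with exponent at least `M`. -/
def HasExponent (P : ℕ → ℝ) (M : ℝ) : Prop :=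
  ∀ ε : ℝ, 0 < ε → ∀ᶠ n : ℕ in atTop, P n ≤ 2 ^ (-(n * (M - ε)))

lemma eventually_mul_le_rpow {A ε : ℝ} (hε : 0 < ε) :
    ∀ᶠ n : ℕ in atTop, A * n ≤ 2 ^ (n * ε) := by
  have hr : (1 : ℝ) < 2 ^ ε := Real.one_lt_rpow one_lt_two hε
  have h1 := tendsto_pow_const_div_const_pow_of_one_lt 1 hr
  have h2 := (h1.const_mul A).eventually (gt_mem_nhds (by simp : A * 0 < 1))
  filter_upwards [h2] with n hn
  have hpos : (0 : ℝ) < (2 ^ ε) ^ n := by positivity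
  rw [pow_one, ← mul_div_assoc, div_lt_one hpos] at hn
  rw [mul_comm (n : ℝ), Real.rpow_mul (by norm_num), Real.rpow_natCast]
  exact hn.le

/-- Factors that grow linearly do not affect the exponent. -/
lemma HasExponent.of_linear {P : ℕ → ℝ} {M A : ℝ}
    (hP : ∀ ε : ℝ, 0 < ε → ∀ᶠ n : ℕ in atTop, P n ≤ A * n * 2 ^ (-(n * (M - ε)))) :
    HasExponent P M := by
  intro ε hε
  filter_upwards [hP (ε / 2) (by positivity),
    eventually_mul_le_rpow (A := A) (ε := ε / 2) (by positivity)] with n h1 h2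
  refine h1.trans ((mul_le_mul_of_nonneg_right h2 (by positivity)).trans (le_of_eq ?_))
  rw [← Real.rpow_add (by norm_num)]
  congr 1; ring

lemma HasExponent.mono {P Q : ℕ → ℝ} {M : ℝ} (hQ : HasExponent Q M) (h : ∀ n, P n ≤ Q n) :
    HasExponent P M := fun ε hε => (hQ ε hε).mono fun n hn => (h n).trans hn

lemma HasExponent.add {P Q : ℕ → ℝ} {M : ℝ} (hP : HasExponent P M) (hQ : HasExponent Q M) :
    HasExponent (fun n => P n + Q n) M := by
  refine HasExponent.of_linear (A := 2) fun ε hε => ?_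
  filter_upwards [hP ε hε, hQ ε hε, eventually_ge_atTop 1] with n h1 h2 hn
  have hn' : (1 : ℝ) ≤ n := by exact_mod_cast hn
  have : (0 : ℝ) < 2 ^ (-(n * (M - ε))) := by positivity
  nlinarith

lemma HasExponent.le_liminf {P : ℕ → ℝ} {M : ℝ} (hP0 : ∀ n, 0 ≤ P n) (hP : HasExponent P M) :
    (M : EReal) ≤ liminf (fun n : ℕ => exponent n (P n)) atTop := by
  refine EReal.ge_of_forall_gt_iff_ge.1 fun a ha => ?_
  have ha' : a < M := by exact_mod_cast ha
  refine le_liminf_of_le ?_ ?_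
  · isBoundedDefault
  filter_upwards [hP (M - a) (by linarith), eventually_gt_atTop 0] with n hn hn0
  rw [exponent]
  split_ifs with h0
  · exact le_top
  have hpos : 0 < P n := lt_of_le_of_ne (hP0 n) (Ne.symm h0)
  have hn0' : (0 : ℝ) < n := by exact_mod_cast hn0
  have h1 : Real.logb 2 (P n) ≤ -(n * (M - (M - a))) :=
    (Real.logb_le_iff_le_rpow one_lt_two hpos).2 hn
  rw [EReal.coe_le_coe_iff, le_div_iff₀ hn0']
  linarith

/-! ### Exponents of codes with a good spectrum -/

open Classical in
/-- A sequence of codes of rate `R` whose weight spectra are, up to a linear factor, at most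
the average spectrum of a random linear code. -/
def GoodSpectrum {R : ℝ} (C : (n : ℕ) → CodeOfRate R n) : Prop :=
  ∀ n, ∑ c with c ∈ (C n).1 ∧ c ≠ 0, ((n.choose (hammingNorm c) : ℝ))⁻¹
    ≤ n * (2 ^ ⌈R * n⌉₊ / 2 ^ n)

lemma exists_goodSpectrum {R : ℝ} (hR1 : R ≤ 1) :
    ∃ C : (n : ℕ) → CodeOfRate R n, GoodSpectrum C := by
  have hk : ∀ n : ℕ, ⌈R * n⌉₊ ≤ n := fun n =>
    Nat.ceil_le.2 (mul_le_of_le_one_left (by positivity) hR1)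
  choose C hC hC' using fun n => exists_code_spectrum (hk n)
  exact ⟨fun n => ⟨C n, hC n⟩, hC'⟩

lemma two_pow_ceil_div_le {R : ℝ} (hR0 : 0 ≤ R) (n : ℕ) :
    (2 : ℝ) ^ ⌈R * n⌉₊ / 2 ^ n ≤ 2 * 2 ^ (-(n * (1 - R))) := by
  have h1 : ((⌈R * n⌉₊ : ℕ) : ℝ) ≤ R * n + 1 := (Nat.ceil_lt_add_one (by positivity)).le
  rw [← Real.rpow_natCast, ← Real.rpow_natCast, ← Real.rpow_sub (by norm_num)]
  nth_rewrite 2 [← Real.rpow_one 2]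
  rw [← Real.rpow_add (by norm_num)]
  exact Real.rpow_le_rpow_of_exponent_le (by norm_num) (by linarith)

lemma two_rpow_logb_mul {x : ℝ} (hx : 0 < x) (a : ℝ) : x ^ a = 2 ^ (Real.logb 2 x * a) := by
  rw [Real.rpow_mul (by norm_num), Real.rpow_logb (by norm_num) (by norm_num) hx]

/-- Codes with a good spectrum meet the Gilbert–Varshamov bound: below relative weight `δ - ε`
the bound on the spectrum is less than one. -/
lemma GoodSpectrum.weight_ge {R : ℝ} (hR0 : 0 ≤ R) (hR1 : R ≤ 1) {C : (n : ℕ) → CodeOfRate R n}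
    (hC : GoodSpectrum C) {ε : ℝ} (hε : 0 < ε) :
    ∀ᶠ n : ℕ in atTop, ∀ c ∈ (C n).1, c ≠ 0 → (δGV R - ε) * n ≤ (hammingNorm c : ℝ) := by
  classical
  obtain ⟨hδ0, hδ1⟩ := δGV_mem hR0 hR1
  have hh := h_δGV hR0 hR1
  set d := δGV R
  rcases hδ0.eq_or_lt with h0 | hpos
  · refine Eventually.of_forall fun n c _ _ => ?_
    rw [← h0]
    have : (0 : ℝ) ≤ hammingNorm c := by positivity
    have : 0 ≤ ε * n := by positivity
    linarith
  -- `δ = 1/2` is rate `0`, where the code is trivial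
  rcases hδ1.eq_or_lt with h1 | hlt
  · have hR : R = 0 := by rw [h1, h_half] at hh; linarith
    refine Eventually.of_forall fun n c hc hc0 => ?_
    exfalso
    have h2 : Module.finrank (ZMod 2) (C n).1 = 0 := by simp [(C n).2, hR]
    rw [Submodule.finrank_eq_zero] at h2
    rw [h2] at hc
    exact hc0 (by simpa using hc)
  · have hd1 : 0 < 1 - d := by linarith
    -- with this `y` the bound `(1 + y)^n y^(-dn)` on a binomial coefficient is `2^(n h(d))`
    set y := d / (1 - d) with hy
    have hy0 : 0 < y := by positivity
    have hy1 : y < 1 := by rw [hy, div_lt_one hd1]; linarith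
    have hLy : Real.logb 2 y < 0 := Real.logb_neg one_lt_two hy0 hy1
    have hS : Real.logb 2 (1 + y) - d * Real.logb 2 y = 1 - R := by
      have e : 1 + y = (1 - d)⁻¹ := by rw [hy]; field_simp; ring
      rw [← hh, e, hy, Real.logb_div hpos.ne' hd1.ne', Real.logb_inv, h, T]
      ring
    filter_upwards [eventually_mul_le_rpow (A := 2 * 2) (ε := ε * -Real.logb 2 y)
      (mul_pos hε (neg_pos.2 hLy)), eventually_gt_atTop 0] with n hn hn0 c hc hc0
    by_contra hlt'
    push Not at hlt'
    have hn0' : (0 : ℝ) < n := by exact_mod_cast hn0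
    have hbpos : (0 : ℝ) < n.choose (hammingNorm c) := by
      exact_mod_cast Nat.choose_pos (hammingNorm_le c)
    have h1 : ((n.choose (hammingNorm c) : ℝ))⁻¹ ≤ n * (2 * 2 ^ (-(n * (1 - R)))) := by
      refine le_trans ?_ ((hC n).trans
        (mul_le_mul_of_nonneg_left (two_pow_ceil_div_le hR0 n) (by positivity)))
      exact Finset.single_le_sum (f := fun c : Word n => ((n.choose (hammingNorm c) : ℝ))⁻¹)
        (fun i _ => by positivity)
        (show c ∈ Finset.univ.filter (fun c => c ∈ (C n).1 ∧ c ≠ 0) by simp [hc, hc0])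
    have h2 := choose_mul_pow_le (n := n) zero_le_one hy0.le (hammingNorm_le c)
    rw [one_pow, one_mul] at h2
    have h3 : (2 : ℝ) ^ (Real.logb 2 y * ((d - ε) * n)) ≤ y ^ hammingNorm c := by
      rw [← two_rpow_logb_mul hy0, ← Real.rpow_natCast]
      exact Real.rpow_le_rpow_of_exponent_ge hy0 hy1.le hlt'.le
    have h4 : (1 + y) ^ n = (2 : ℝ) ^ (Real.logb 2 (1 + y) * n) := by
      rw [← two_rpow_logb_mul (by positivity), Real.rpow_natCast]
    have h5 : (n.choose (hammingNorm c) : ℝ) *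
        2 ^ (Real.logb 2 y * ((d - ε) * n)) ≤ 2 ^ (Real.logb 2 (1 + y) * n) :=
      (mul_le_mul_of_nonneg_left h3 hbpos.le).trans (h2.trans h4.le)
    have h6 : (n.choose (hammingNorm c) : ℝ)
        ≤ 2 ^ (n * (1 - R) + n * (ε * Real.logb 2 y)) := by
      have e : (2 : ℝ) ^ (n * (1 - R) + n * (ε * Real.logb 2 y)) =
          2 ^ (Real.logb 2 (1 + y) * n) / 2 ^ (Real.logb 2 y * ((d - ε) * n)) := by
        rw [← Real.rpow_sub (by norm_num), ← hS]
        congr 1; ring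
      rwa [e, le_div_iff₀ (by positivity)]
    have h7 : (1 : ℝ) ≤ n * (2 * 2 ^ (-(n * (1 - R)))) * n.choose (hammingNorm c) := by
      rwa [inv_le_iff_one_le_mul₀ hbpos] at h1
    have h8 : (1 : ℝ) ≤ n * (2 * 2 ^ (-(n * (1 - R)))) *
        2 ^ (n * (1 - R) + n * (ε * Real.logb 2 y)) :=
      h7.trans (mul_le_mul_of_nonneg_left h6 (by positivity))
    have h9 : n * (2 * (2 : ℝ) ^ (-(n * (1 - R)))) *
        2 ^ (n * (1 - R) + n * (ε * Real.logb 2 y)) = 2 * n * 2 ^ (n * (ε * Real.logb 2 y)) := by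
      have : (2 : ℝ) ^ (-(n * (1 - R))) * 2 ^ (n * (1 - R) + n * (ε * Real.logb 2 y)) =
          2 ^ (n * (ε * Real.logb 2 y)) := by
        rw [← Real.rpow_add (by norm_num)]; congr 1; ring
      rw [← this]; ring
    rw [h9] at h8
    have h10 : (2 : ℝ) ^ (n * (ε * -Real.logb 2 y)) * 2 ^ (n * (ε * Real.logb 2 y)) = 1 := by
      rw [← Real.rpow_add (by norm_num)]
      rw [show (n : ℝ) * (ε * -Real.logb 2 y) + n * (ε * Real.logb 2 y) = 0 by ring,
        Real.rpow_zero]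
    have h11 : (0 : ℝ) < 2 ^ (n * (ε * Real.logb 2 y)) := by positivity
    have h12 := mul_le_mul_of_nonneg_right hn h11.le
    rw [h10] at h12
    nlinarith

/-- The exponent of the Chernoff bound at rate `R`, signed relative threshold `t` and relative
minimum weight `d`. The tilting parameters `z`, `y`, `v` belong to the constraints
`|x| - |x - c| ≥ 2tn`, `|c| ≥ dn` and `|x| ≤ (d + 2t)n` on the received word `x` and the
codeword `c`. -/
noncomputable def chernoffExponent (p R d t z y v : ℝ) : ℝ :=
  1 - R + 2 * t * Real.logb 2 z + d * Real.logb 2 y - (d + 2 * t) * Real.logb 2 v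
    - Real.logb 2 ((1 - p) + p / v + y * ((1 - p) * z⁻¹ + p / v * z))

open Classical in
/-- The minimum weight of the codes is only `(δ - η)n`, which costs `η log₂ y` in the exponent. -/
lemma GoodSpectrum.hasExponent_chernoff {R : ℝ} (hR0 : 0 ≤ R) (hR1 : R ≤ 1)
    {C : (n : ℕ) → CodeOfRate R n} (hC : GoodSpectrum C) {p t z y v : ℝ} (hp0 : 0 < p)
    (hp1 : p < 1) (hz : 0 < z) (hy : 1 ≤ y) (hv : 0 < v) :
    HasExponent (fun n => v ^ ((δGV R + 2 * t) * n) * z ^ (-(2 * t * n)) *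
      ∑ c with c ∈ (C n).1 ∧ c ≠ 0, ((1 - p) + p / v) ^ (n - hammingNorm c) *
          ((1 - p) * z⁻¹ + p / v * z) ^ hammingNorm c)
      (chernoffExponent p R (δGV R) t z y v) := by
  refine HasExponent.of_linear (A := 2) fun ε hε => ?_
  have hy0 : 0 < y := by linarith
  have hq : 0 < 1 - p := by linarith
  have hLy : 0 ≤ Real.logb 2 y := Real.logb_nonneg one_lt_two hy
  set d := δGV R with hd
  set S := (1 - p) + p / v + y * ((1 - p) * z⁻¹ + p / v * z) with hSdef
  have hS : 0 < S := by positivity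
  set η := ε / (Real.logb 2 y + 1) with hη
  have hη0 : 0 < η := by positivity
  have hηle : η * Real.logb 2 y ≤ ε := by
    rw [hη, div_mul_eq_mul_div, div_le_iff₀ (by positivity)]
    nlinarith
  filter_upwards [hC.weight_ge hR0 hR1 hη0] with n hn
  have h1 := sum_code_le_of_weight (C n).1 (a := (1 - p) + p / v)
    (b := (1 - p) * z⁻¹ + p / v * z) (L := (d - η) * n) (by positivity) (by positivity) hy (hC n)
    hn
  have h2 : (n : ℝ) * (2 ^ ⌈R * n⌉₊ / 2 ^ n) * S ^ n ≤ n * (2 * 2 ^ (-(n * (1 - R)))) * S ^ n :=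
    mul_le_mul_of_nonneg_right
      (mul_le_mul_of_nonneg_left (two_pow_ceil_div_le hR0 n) (by positivity)) (by positivity)
  refine (mul_le_mul_of_nonneg_left (h1.trans (mul_le_mul_of_nonneg_left h2 (by positivity)))
    (by positivity)).trans ?_
  rw [two_rpow_logb_mul hv, two_rpow_logb_mul hz, two_rpow_logb_mul hy0, ← Real.rpow_natCast S,
    two_rpow_logb_mul hS]
  have e : ∀ a b c e f : ℝ, (2 : ℝ) ^ a * 2 ^ b * (2 ^ c * (n * (2 * 2 ^ e) * 2 ^ f)) =
      2 * n * 2 ^ (a + b + c + e + f) := by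
    intro a b c e f
    rw [Real.rpow_add (by norm_num), Real.rpow_add (by norm_num), Real.rpow_add (by norm_num),
      Real.rpow_add (by norm_num)]
    ring
  rw [e]
  refine mul_le_mul_of_nonneg_left (Real.rpow_le_rpow_of_exponent_le (by norm_num) ?_)
    (by positivity)
  rw [chernoffExponent, ← hSdef]
  have : (n : ℝ) * (η * Real.logb 2 y) ≤ n * ε := mul_le_mul_of_nonneg_left hηle (by positivity)
  nlinarith

/-- The binomial tail has the exponent `D(e‖p)`; the parameter `v` tilts `p` to `e`. -/
lemma hasExponent_tail {p e : ℝ} (hp0 : 0 < p) (hpe : p ≤ e) (he : e < 1) :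
    ∃ v : ℝ, 1 ≤ v ∧
      HasExponent (fun n => v ^ (-(e * n)) * ((1 - p) + p * v) ^ n) (D e p) := by
  have he0 : 0 < e := by linarith
  have hq : 0 < 1 - p := by linarith
  have hf : 0 < 1 - e := by linarith
  refine ⟨e * (1 - p) / ((1 - e) * p), ?_, ?_⟩
  · rw [le_div_iff₀ (by positivity)]; nlinarith
  · intro ε hε
    refine Eventually.of_forall fun n => ?_
    have hS : (1 - p) + p * (e * (1 - p) / ((1 - e) * p)) = (1 - p) / (1 - e) := by
      field_simp; ring
    beta_reduce
    rw [hS, two_rpow_logb_mul (by positivity), ← Real.rpow_natCast,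
      two_rpow_logb_mul (x := (1 - p) / (1 - e)) (by positivity), ← Real.rpow_add (by norm_num)]
    refine Real.rpow_le_rpow_of_exponent_le (by norm_num) ?_
    rw [Real.logb_div (by positivity) (by positivity), Real.logb_mul (by positivity)
      (by positivity), Real.logb_mul (by positivity) (by positivity),
      Real.logb_div (by positivity) (by positivity), D, h, T, T]
    have : 0 ≤ n * ε := by positivity
    nlinarith

/-! ### Duality between joint types and tilting parameters -/

/-- The exponent of the expected number of pairs (received word, codeword) whose joint type has the
cell frequencies `a, b, c, d` at `(0,0), (0,1), (1,0), (1,1)`, each pair counted with the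
probability of its received word: `1 - R` plus `T` at the weight `c + d` of the received word, less
the entropy of the type. -/
noncomputable def typeExponent (p R a b c d : ℝ) : ℝ :=
  1 - R + T (c + d) p +
    (a * Real.logb 2 a + b * Real.logb 2 b + c * Real.logb 2 c + d * Real.logb 2 d)

/-- The average logarithm, over a type, of the four tilted weights whose sum occurs in
`chernoffExponent`. -/
lemma sum_mul_logb_weights {p z y v a b c d : ℝ} (hp0 : 0 < p) (hp1 : p < 1) (hz : 0 < z)
    (hy : 0 < y) (hv : 0 < v) (hsum : a + b + c + d = 1) :
    a * Real.logb 2 (1 - p) + b * Real.logb 2 (y * ((1 - p) * z⁻¹)) + c * Real.logb 2 (p / v) +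
      d * Real.logb 2 (y * (p / v * z)) =
    -T (c + d) p + (d - b) * Real.logb 2 z + (b + d) * Real.logb 2 y
      - (c + d) * Real.logb 2 v := by
  have hq : 0 < 1 - p := by linarith
  rw [Real.logb_mul hy.ne' (by positivity), Real.logb_mul hq.ne' (by positivity), Real.logb_inv,
    Real.logb_div hp0.ne' hv.ne', Real.logb_mul hy.ne' (by positivity),
    Real.logb_mul (by positivity) hz.ne', Real.logb_div hp0.ne' hv.ne', T]
  have : a = 1 - b - c - d := by linarith
  rw [this]; ring

/-- Equality in the duality between types and tilting parameters holds when the tilted weights are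
`S` times the cell frequencies; the last three terms vanish under complementary slackness. -/
lemma chernoffExponent_eq {p R δ t z y v a b c d S : ℝ} (hp0 : 0 < p) (hp1 : p < 1) (hz : 0 < z)
    (hy : 0 < y) (hv : 0 < v) (ha : 0 < a) (hb : 0 < b) (hc : 0 < c) (hd : 0 < d)
    (hsum : a + b + c + d = 1) (h00 : 1 - p = S * a) (h01 : y * ((1 - p) * z⁻¹) = S * b)
    (h10 : p / v = S * c) (h11 : y * (p / v * z) = S * d) :
    chernoffExponent p R δ t z y v = typeExponent p R a b c d
      + (2 * t - (d - b)) * Real.logb 2 z + (δ - (b + d)) * Real.logb 2 y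
      - (δ + 2 * t - (c + d)) * Real.logb 2 v := by
  have hS : 0 < S := by
    have : 0 < S * a := h00 ▸ (by linarith)
    exact pos_of_mul_pos_left this ha.le
  have hw := sum_mul_logb_weights hp0 hp1 hz hy hv hsum
  have hSe : (1 - p) + p / v + y * ((1 - p) * z⁻¹ + p / v * z) = S := by
    rw [mul_add, h01, h11, h10, h00]
    linear_combination S * hsum
  rw [h01, h11, h10, h00, Real.logb_mul hS.ne' ha.ne', Real.logb_mul hS.ne' hb.ne',
    Real.logb_mul hS.ne' hc.ne', Real.logb_mul hS.ne' hd.ne'] at hw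
  rw [chernoffExponent, hSe, typeExponent]
  linear_combination (-1 : ℝ) * hw + Real.logb 2 S * hsum

lemma mul_log_sub_log_le {x w : ℝ} (hx : 0 < x) (hw : 0 < w) :
    x * (Real.log w - Real.log x) ≤ w - x := by
  rw [← Real.log_div hw.ne' hx.ne']
  have := mul_le_mul_of_nonneg_left (Real.log_le_sub_one_of_pos (div_pos hw hx)) hx.le
  rwa [mul_sub, mul_div_cancel₀ _ hx.ne', mul_one] at this

lemma mul_log_sub_log_lt {x w : ℝ} (hx : 0 < x) (hw : 0 < w) (hne : w ≠ x) :
    x * (Real.log w - Real.log x) < w - x := by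
  rw [← Real.log_div hw.ne' hx.ne']
  have := mul_lt_mul_of_pos_left (Real.log_lt_sub_one_of_pos (div_pos hw hx)
    (by rwa [Ne, div_eq_one_iff_eq hx.ne'])) hx
  rwa [mul_sub, mul_div_cancel₀ _ hx.ne', mul_one] at this

/-- Strict Gibbs inequality on four cells, for weights that agree on two cells where the
distribution does not. -/
lemma gibbs_lt {a b c d w₀ w₁ w₂ : ℝ} (ha : 0 < a) (hb : 0 < b) (hc : 0 < c) (hd : 0 < d)
    (hsum : a + b + c + d = 1) (h0 : 0 < w₀) (h1 : 0 < w₁) (h2 : 0 < w₂) (hne : b ≠ d) :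
    a * Real.logb 2 w₀ + b * Real.logb 2 w₁ + c * Real.logb 2 w₂ + d * Real.logb 2 w₁
      < (a * Real.logb 2 a + b * Real.logb 2 b + c * Real.logb 2 c + d * Real.logb 2 d)
        + Real.logb 2 (w₀ + w₁ + w₂ + w₁) := by
  set S := w₀ + w₁ + w₂ + w₁ with hS
  have hS0 : 0 < S := by positivity
  have key : a * (Real.log (w₀ / S) - Real.log a) + b * (Real.log (w₁ / S) - Real.log b)
      + c * (Real.log (w₂ / S) - Real.log c) + d * (Real.log (w₁ / S) - Real.log d) < 0 := by
    have ea := mul_log_sub_log_le ha (div_pos h0 hS0)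
    have eb := mul_log_sub_log_le hb (div_pos h1 hS0)
    have ec := mul_log_sub_log_le hc (div_pos h2 hS0)
    have ed := mul_log_sub_log_le hd (div_pos h1 hS0)
    have etot : w₀ / S + w₁ / S + w₂ / S + w₁ / S = 1 := by
      rw [← add_div, ← add_div, ← add_div, ← hS, div_self hS0.ne']
    by_cases hbe : w₁ / S = b
    · have := mul_log_sub_log_lt hd (div_pos h1 hS0) (fun h => hne (hbe.symm.trans h))
      linarith
    · have := mul_log_sub_log_lt hb (div_pos h1 hS0) hbe
      linarith
  rw [Real.log_div h0.ne' hS0.ne', Real.log_div h1.ne' hS0.ne',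
    Real.log_div h2.ne' hS0.ne'] at key
  have hl2 : 0 < Real.log 2 := Real.log_pos one_lt_two
  simp only [Real.logb]
  have e : ∀ x y, x * (y / Real.log 2) = x * y / Real.log 2 := fun x y => by ring
  simp only [e]
  rw [← add_div, ← add_div, ← add_div, ← add_div, ← add_div, ← add_div, ← add_div]
  refine div_lt_div_of_pos_right ?_ hl2
  linear_combination key + Real.log S * hsum

/-- Strict weak duality between types and tilting parameters. -/
lemma chernoffExponent_lt {p R δ t z y v a b c d : ℝ} (hp0 : 0 < p) (hp1 : p < 1) (hz : 0 < z)
    (hy : 0 < y) (hv : 0 < v) (ha : 0 < a) (hb : 0 < b) (hc : 0 < c) (hd : 0 < d)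
    (hsum : a + b + c + d = 1) (hw : (1 - p) * z⁻¹ = p / v * z) (hne : b ≠ d) :
    chernoffExponent p R δ t z y v < typeExponent p R a b c d
      + (2 * t - (d - b)) * Real.logb 2 z + (δ - (b + d)) * Real.logb 2 y
      - (δ + 2 * t - (c + d)) * Real.logb 2 v := by
  have hq : 0 < 1 - p := by linarith
  have h1 := sum_mul_logb_weights hp0 hp1 hz hy hv hsum
  have h2 := gibbs_lt ha hb hc hd hsum hq (mul_pos hy (by positivity : 0 < (1 - p) * z⁻¹))
    (div_pos hp0 hv) hne
  rw [← hw] at h1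
  have e : (1 - p) + p / v + y * ((1 - p) * z⁻¹ + p / v * z) =
      (1 - p) + y * ((1 - p) * z⁻¹) + p / v + y * ((1 - p) * z⁻¹) := by rw [← hw]; ring
  rw [chernoffExponent, e, typeExponent]
  linarith

/-- Types in which the received word is independent of its difference with the codeword. -/
lemma typeExponent_product {p R e e' : ℝ} (he0 : 0 < e) (he1 : e < 1) (he0' : 0 < e')
    (he1' : e' < 1) :
    typeExponent p R ((1 - e) * (1 - e')) ((1 - e) * e') (e * e') (e * (1 - e')) =
      D e p + (1 - R - h e') := by
  have h1 : 0 < 1 - e := by linarith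
  have h2 : 0 < 1 - e' := by linarith
  rw [typeExponent, Real.logb_mul h1.ne' h2.ne', Real.logb_mul h1.ne' he0'.ne',
    Real.logb_mul he0.ne' he0'.ne', Real.logb_mul he0.ne' h2.ne', D, h, h, T, T, T, T]
  ring

/-- Types in which the received word is distributed like the noise off the support of the
codeword, which has relative weight `δ`. -/
lemma typeExponent_conditional {p R δ α : ℝ} (hp0 : 0 < p) (hp1 : p < 1) (hδ0 : 0 < δ)
    (hδ1 : δ < 1) (hα0 : 0 < α) (hα1 : α < 1) :
    typeExponent p R ((1 - δ) * (1 - p)) (δ * (1 - α)) ((1 - δ) * p) (δ * α) =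
      1 - R - h δ + δ * D α p := by
  have h1 : 0 < 1 - p := by linarith
  have h2 : 0 < 1 - δ := by linarith
  have h3 : 0 < 1 - α := by linarith
  rw [typeExponent, Real.logb_mul h2.ne' h1.ne', Real.logb_mul h2.ne' hp0.ne',
    Real.logb_mul hδ0.ne' hα0.ne', Real.logb_mul hδ0.ne' h3.ne', D, h, h, T, T, T, T]
  ring

/-- The tilting parameters `z`, `v` fit the independent type with weight `e` of the received word
and distance `e'` to the codeword. -/
lemma chernoffExponent_product {p R δ t e e' z v : ℝ} (hp0 : 0 < p) (hp1 : p < 1) (he0 : 0 < e)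
    (he1 : e < 1) (he0' : 0 < e') (he1' : e' < 1) (hz : z = (1 - e') / e')
    (hv : v = p * (1 - e) * (1 - e') / ((1 - p) * e * e')) :
    chernoffExponent p R δ t z 1 v = D e p + (1 - R - h e')
      + (2 * t - (e - e')) * Real.logb 2 z - (δ + 2 * t - e) * Real.logb 2 v := by
  have h0 : 0 < 1 - p := by linarith
  have h1 : 0 < 1 - e := by linarith
  have h2 : 0 < 1 - e' := by linarith
  have hv0 : 0 < v := by rw [hv]; positivity
  have hz0 : 0 < z := by rw [hz]; positivity
  have hpv : p / v = (1 - p) * e * e' / ((1 - e) * (1 - e')) := by rw [hv]; field_simp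
  rw [chernoffExponent_eq (a := (1 - e) * (1 - e')) (b := (1 - e) * e') (c := e * e')
    (d := e * (1 - e')) (S := (1 - p) / ((1 - e) * (1 - e'))) hp0 hp1 hz0 one_pos hv0
    (by positivity) (by positivity) (by positivity) (by positivity) (by ring) (by field_simp)
    (by rw [hz]; field_simp) (by rw [hpv]; field_simp) (by rw [hpv, hz]; field_simp),
    typeExponent_product he0 he1 he0' he1', Real.logb_one]
  ring

/-- The tilting parameters `z`, `y` fit the conditional type; `B` is the factor contributed by a
coordinate in the support of the codeword. -/
lemma chernoffExponent_conditional {p R δ t α z B y : ℝ} (hp0 : 0 < p) (hp1 : p < 1)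
    (hδ0 : 0 < δ) (hδ1 : δ < 1) (hα0 : 0 < α) (hα1 : α < 1) (hz0 : 0 < z)
    (hz : p * z ^ 2 * (1 - α) = α * (1 - p)) (hB : B = p * z / α)
    (hy : y = δ / ((1 - δ) * B)) :
    chernoffExponent p R δ t z y 1 = 1 - R - h δ + δ * D α p
      + (2 * t - δ * (2 * α - 1)) * Real.logb 2 z := by
  have h1 : 0 < 1 - p := by linarith
  have h2 : 0 < 1 - δ := by linarith
  have h3 : 0 < 1 - α := by linarith
  have hB0 : 0 < B := by rw [hB]; positivity
  have hy0 : 0 < y := by rw [hy]; positivity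
  have hB' : (1 - p) * z⁻¹ = (1 - α) * B := by
    rw [hB, ← div_eq_mul_inv, mul_div_assoc', div_eq_div_iff hz0.ne' hα0.ne']
    linear_combination -hz
  have hB'' : p * z = α * B := by rw [hB]; field_simp
  rw [chernoffExponent_eq (a := (1 - δ) * (1 - p)) (b := δ * (1 - α)) (c := (1 - δ) * p)
    (d := δ * α) (S := (1 - δ)⁻¹) hp0 hp1 hz0 hy0 one_pos
    (by positivity) (by positivity) (by positivity) (by positivity) (by ring) (by field_simp)
    (by rw [hB', hy]; field_simp) (by field_simp) (by rw [div_one, hB'', hy]; field_simp),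
    typeExponent_conditional hp0 hp1 hδ0 hδ1 hα0 hα1, Real.logb_one]
  ring

lemma conditional_factor_sq {p α z B : ℝ} (hα0 : 0 < α)
    (hz : p * z ^ 2 * (1 - α) = α * (1 - p)) (hB : B = p * z / α) :
    B ^ 2 * (α * (1 - α)) = p * (1 - p) := by
  rw [hB]; field_simp
  linear_combination p * hz

/-! ### The critical values of the Gilbert–Varshamov distance -/

/-- The number `r` with `ρ₀^± = r ± τ`. -/
noncomputable def ρmid (p τ : ℝ) : ℝ :=
  (√(u p + τ ^ 2 * (1 - 2 * p) ^ 2) - p) / (1 - 2 * p)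

lemma ρ₀_eq {p τ : ℝ} (σ : ℝ) (hp : p < 1 / 2) : ρ₀ σ p τ = ρmid p τ + σ * τ := by
  have : 1 - 2 * p ≠ 0 := by linarith
  rw [ρ₀, ρmid]; field_simp; ring

lemma radicand_pos {p τ : ℝ} (hp0 : 0 < p) (hp : p < 1 / 2) :
    0 < u p + τ ^ 2 * (1 - 2 * p) ^ 2 := by
  have : 0 < u p := mul_pos hp0 (by linarith)
  positivity

/-- The stationarity condition for `e = r + τ`, `e' = r - τ`: without a limit on the weight of the
received word (`v = 1`) the independent type is fitted by its tilting parameters. -/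
lemma ρmid_quadratic {p τ : ℝ} (hp0 : 0 < p) (hp : p < 1 / 2) :
    (1 - p) * ((ρmid p τ + τ) * (ρmid p τ - τ)) =
      p * ((1 - (ρmid p τ + τ)) * (1 - (ρmid p τ - τ))) := by
  have hne : 1 - 2 * p ≠ 0 := by linarith
  have hsq := Real.sq_sqrt (radicand_pos (τ := τ) hp0 hp).le
  have hr : ρmid p τ * (1 - 2 * p) + p = √(u p + τ ^ 2 * (1 - 2 * p) ^ 2) := by
    rw [ρmid]; field_simp; ring
  rw [← hr, u] at hsq
  refine mul_left_cancel₀ hne ?_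
  linear_combination hsq

lemma lt_ρmid {p τ : ℝ} (hp0 : 0 < p) (hp : p < 1 / 2) (hτ : τ < 1 / 2) :
    τ < ρmid p τ := by
  have h1 : 0 < 1 - 2 * p := by linarith
  rw [ρmid, lt_div_iff₀ h1, lt_sub_iff_add_lt]
  refine Real.lt_sqrt_of_sq_lt ?_
  rw [u]
  nlinarith [mul_pos (mul_pos hp0 h1) (by linarith : 0 < 1 - 2 * τ)]

lemma ρmid_lt_half {p τ : ℝ} (hp0 : 0 < p) (hp : p < 1 / 2) (hτ0 : 0 ≤ τ) (hτ : τ < 1 / 2) :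
    ρmid p τ < 1 / 2 := by
  have h1 : 0 < 1 - 2 * p := by linarith
  rw [ρmid, div_lt_iff₀ h1, sub_lt_iff_lt_add, Real.sqrt_lt' (by linarith), u]
  have : 0 < (1 - 4 * τ ^ 2) * (1 - 2 * p) ^ 2 := mul_pos (by nlinarith) (by positivity)
  nlinarith

lemma ρmid_add_le_half {p τ : ℝ} (hp0 : 0 < p) (hp : p < 1 / 2) (hτ : τ < 1 / 2)
    (hpτ : p + 2 * τ ≤ 1 / 2) : ρmid p τ + τ ≤ 1 / 2 := by
  have hq := ρmid_quadratic (τ := τ) hp0 hp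
  have h0 := lt_ρmid hp0 hp hτ
  by_contra hlt
  push Not at hlt
  have : 0 < (ρmid p τ + τ - 1 / 2) * ((1 - 2 * p) * (ρmid p τ - τ + 1 / 2) + 2 * p) :=
    mul_pos (by linarith) (by
      have := mul_pos (by linarith : 0 < 1 - 2 * p) (by linarith : 0 < ρmid p τ - τ + 1 / 2)
      linarith)
  nlinarith

/-- `ω₀` is the relative weight of the codeword in the independent type of `ρmid_quadratic`. -/
lemma ω₀_eq {p τ : ℝ} (hp0 : 0 < p) (hp : p < 1 / 2) :
    ω₀ p τ = (1 - (ρmid p τ + τ)) * (ρmid p τ - τ) + (ρmid p τ + τ) * (1 - (ρmid p τ - τ)) := by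
  have hne : 1 - 2 * p ≠ 0 := by linarith
  have hq := ρmid_quadratic (τ := τ) hp0 hp
  have e : u p + τ ^ 2 * (1 - 4 * u p) = u p + τ ^ 2 * (1 - 2 * p) ^ 2 := by rw [u]; ring
  have hr : ρmid p τ * (1 - 2 * p) + p = √(u p + τ ^ 2 * (1 - 2 * p) ^ 2) := by
    rw [ρmid]; field_simp; ring
  have h4 : 1 - 4 * u p = (1 - 2 * p) ^ 2 := by rw [u]; ring
  rw [ω₀, e, ← hr, h4, mul_div_assoc', div_eq_iff (by positivity), u]
  linear_combination 2 * (1 - 2 * p) * hq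

lemma ω₀_quadratic {p τ : ℝ} (hp0 : 0 < p) (hp : p < 1 / 2) :
    ω₀ p τ ^ 2 / 4 - τ ^ 2 = u p * (1 - ω₀ p τ) ^ 2 := by
  have hne : 1 - 2 * p ≠ 0 := by linarith
  have h4 : 1 - 4 * u p = (1 - 2 * p) ^ 2 := by rw [u]; ring
  have e : u p + τ ^ 2 * (1 - 4 * u p) = u p + τ ^ 2 * (1 - 2 * p) ^ 2 := by rw [h4]
  have hsq := Real.sq_sqrt (radicand_pos (τ := τ) hp0 hp).le
  have hw : ω₀ p τ * (1 - 4 * u p) / 2 + 2 * u p = √(u p + τ ^ 2 * (1 - 2 * p) ^ 2) := by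
    have : 1 - 4 * u p ≠ 0 := by rw [h4]; positivity
    rw [ω₀, e]
    linear_combination div_mul_cancel₀ (√(u p + τ ^ 2 * (1 - 2 * p) ^ 2) - 2 * u p) this
  rw [← hw, ← e] at hsq
  have : (1 - 4 * u p) ≠ 0 := by rw [h4]; positivity
  refine mul_left_cancel₀ this ?_
  linear_combination hsq

lemma two_mul_lt_ω₀ {p τ : ℝ} (hp0 : 0 < p) (hp : p < 1 / 2) (hτ0 : 0 ≤ τ) (hτ : τ < 1 / 2) :
    2 * τ < ω₀ p τ := by
  rw [ω₀_eq hp0 hp]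
  have h0 := lt_ρmid hp0 hp hτ
  have h1 := ρmid_lt_half hp0 hp hτ0 hτ
  nlinarith [mul_pos (by linarith : 0 < ρmid p τ - τ) (by linarith : 0 < 1 - ρmid p τ - τ)]

lemma ω₀_lt {p τ : ℝ} (hp0 : 0 < p) (hp : p < 1 / 2) (hτ0 : 0 ≤ τ) (hτ : τ < 1 / 2) :
    ω₀ p τ < 1 / 2 + τ := by
  rw [ω₀_eq hp0 hp]
  have h0 := lt_ρmid hp0 hp hτ
  have h1 := ρmid_lt_half hp0 hp hτ0 hτ
  nlinarith [mul_pos (by linarith : 0 < 1 / 2 - ρmid p τ) (by linarith : 0 < 1 / 2 - ρmid p τ),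
    mul_pos (by linarith : 0 < 1 / 2 - τ) (by linarith : 0 < 1 / 2 - τ)]

lemma ω₀_le_half {p τ : ℝ} (hp0 : 0 < p) (hp : p < 1 / 2) (hτ0 : 0 ≤ τ) (hτ : τ < 1 / 2)
    (hpτ : p + 2 * τ ≤ 1 / 2) : ω₀ p τ ≤ 1 / 2 := by
  rw [ω₀_eq hp0 hp]
  have h0 := lt_ρmid hp0 hp hτ
  have h2 := ρmid_add_le_half hp0 hp hτ hpτ
  nlinarith [mul_nonneg (by linarith : 0 ≤ 1 / 2 - ρmid p τ - τ)
    (by linarith : 0 ≤ 1 / 2 - ρmid p τ + τ)]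

/-- The condition `ω₀ ≤ δ` makes the tilting parameter for the weight of the codeword at least
one. -/
lemma le_of_ω₀_le {p τ δ : ℝ} (hp0 : 0 < p) (hp : p < 1 / 2) (hτ0 : 0 ≤ τ) (hτ : τ < 1 / 2)
    (hδ : ω₀ p τ ≤ δ) (hδ1 : δ ≤ 1 / 2) : u p * (1 - δ) ^ 2 ≤ δ ^ 2 / 4 - τ ^ 2 := by
  have h1 := ω₀_quadratic (τ := τ) hp0 hp
  have h2 := two_mul_lt_ω₀ hp0 hp hτ0 hτ
  have hu : 0 < u p := mul_pos hp0 (by linarith)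
  have h3 : (1 - δ) ^ 2 ≤ (1 - ω₀ p τ) ^ 2 := by nlinarith
  have h4 : ω₀ p τ ^ 2 ≤ δ ^ 2 := by nlinarith
  nlinarith [mul_le_mul_of_nonneg_left h3 hu.le]

/-- The critical rates of `M`, read as critical values of the Gilbert–Varshamov distance. The
assumptions `hω`, `hρ0`, `hρ1` ensure that `h` is compared where it is increasing: `ω₀` may exceed
`1/2`, but then `h(ω₀) ≤ h(δ)` would need `δ ≥ 1 - ω₀`. -/
lemma M_cases {R p τ σ : ℝ} (hR0 : 0 ≤ R) (hR1 : R ≤ 1) (hp0 : 0 < p) (hp : p < 1 / 2)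
    (hτ0 : 0 ≤ τ) (hτ : τ < 1 / 2) (hω : ω₀ p τ ≤ 1 / 2 ∨ δGV R < 1 - ω₀ p τ)
    (hρ0 : 0 ≤ ρmid p τ - σ * τ) (hρ1 : ρmid p τ - σ * τ ≤ 1 / 2) :
    (ω₀ p τ ≤ δGV R ∧ M σ R p τ = -(δGV R) * (h (1 / 2 + τ / δGV R) + 1 / 2 * Real.logb 2 (u p))
        + σ * (ν p * τ)) ∨
    (δGV R < ω₀ p τ ∧ ρmid p τ - σ * τ ≤ δGV R ∧
      M σ R p τ = D (ρmid p τ + σ * τ) p + (1 - R - h (ρmid p τ - σ * τ))) ∨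
    (δGV R < ρmid p τ - σ * τ ∧ M σ R p τ = D (δGV R + 2 * (σ * τ)) p) := by
  have hδ := δGV_mem hR0 hR1
  have hh := h_δGV hR0 hR1
  have hω0 := two_mul_lt_ω₀ hp0 hp hτ0 hτ
  have hω1 := ω₀_lt hp0 hp hτ0 hτ
  have e : ρ₀ σ p τ - σ * (2 * τ) = ρmid p τ - σ * τ := by rw [ρ₀_eq σ hp]; ring
  rw [M, e]
  have ha : R ≤ 1 - h (ω₀ p τ) ↔ ω₀ p τ ≤ δGV R := by
    have e1 : R ≤ 1 - h (ω₀ p τ) ↔ h (ω₀ p τ) ≤ h (δGV R) := by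
      rw [hh]; constructor <;> intro h <;> linarith
    rw [e1]
    by_cases hle : ω₀ p τ ≤ 1 / 2
    · exact h_le_iff ⟨by linarith, hle⟩ hδ
    · have hlt := hω.resolve_left hle
      rw [← h_one_sub, h_le_iff ⟨by linarith, by linarith⟩ hδ]
      constructor
      · intro h; linarith
      · intro h; linarith [hδ.2]
  have hb : R ≤ 1 - h (ρmid p τ - σ * τ) ↔ ρmid p τ - σ * τ ≤ δGV R := by
    rw [← h_le_iff ⟨hρ0, hρ1⟩ hδ, hh]
    constructor <;> intro h <;> linarith
  simp only [ha, hb]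
  split_ifs with h1 h2
  · exact Or.inl ⟨h1, rfl⟩
  · refine Or.inr (Or.inl ⟨not_le.1 h1, h2, ?_⟩)
    rw [ρ₀_eq σ hp]; ring
  · refine Or.inr (Or.inr ⟨not_le.1 h2, ?_⟩)
    congr 1; ring

/-- The first piece of `M` is the exponent of confusing two codewords at distance `δn`. -/
lemma mul_D_half_add {p δ t τ : ℝ} (hp0 : 0 < p) (hp : p < 1 / 2) (hδ : 0 < δ)
    (ht : t = τ ∨ t = -τ) :
    δ * D (1 / 2 + t / δ) p =
      -δ * (h (1 / 2 + τ / δ) + 1 / 2 * Real.logb 2 (u p)) + ν p * t := by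
  have hq : 0 < 1 - p := by linarith
  have hh : h (1 / 2 + t / δ) = h (1 / 2 + τ / δ) := by
    rcases ht with rfl | rfl
    · rfl
    · rw [← h_one_sub]; congr 1; ring
  rw [D, hh, T, u, ν, Real.logb_mul hp0.ne' hq.ne', Real.logb_div hq.ne' hp0.ne']
  field_simp
  ring

/-! ### Achievability of the exponent `M` -/

/-- The minimum weight is active: errors are dominated by codewords of weight about `δn`. -/
lemma GoodSpectrum.hasExponent_conditional {R : ℝ} (hR0 : 0 ≤ R) (hR1 : R ≤ 1)
    {C : (n : ℕ) → CodeOfRate R n} (hC : GoodSpectrum C) {p t : ℝ} (hp0 : 0 < p) (hp : p < 1 / 2)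
    (hδ : 0 < δGV R) (hα : p ≤ 1 / 2 + t / δGV R) (hα1 : 1 / 2 + t / δGV R < 1)
    (hy : u p * (1 - δGV R) ^ 2 ≤ δGV R ^ 2 / 4 - t ^ 2) :
    HasExponent (fun n => confusionProb (C n).1 (2 * t * n) p)
      (δGV R * D (1 / 2 + t / δGV R) p) := by
  have hδ1 := (δGV_mem hR0 hR1).2
  have hh := h_δGV hR0 hR1
  set d := δGV R with hd
  set α := 1 / 2 + t / d with hαdef
  have hq : 0 < 1 - p := by linarith
  have hα0 : 0 < α := by linarith
  have hα1' : 0 < 1 - α := by linarith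
  have hd1 : 0 < 1 - d := by linarith
  -- `z` tilts the noise on the support of the codeword from `p` to `α`
  set z := √(α * (1 - p) / ((1 - α) * p)) with hzdef
  have hz2 : z ^ 2 = α * (1 - p) / ((1 - α) * p) := Real.sq_sqrt (by positivity)
  have hz : p * z ^ 2 * (1 - α) = α * (1 - p) := by rw [hz2]; field_simp
  have hz1 : 1 ≤ z := by
    rw [hzdef, Real.one_le_sqrt, le_div_iff₀ (by positivity)]; nlinarith
  have hz0 : 0 < z := by linarith
  obtain ⟨B, hB⟩ : ∃ B, B = p * z / α := ⟨_, rfl⟩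
  have hB0 : 0 < B := by rw [hB]; positivity
  have hBsq := conditional_factor_sq hα0 hz hB
  have hαα : α * (1 - α) * d ^ 2 = d ^ 2 / 4 - t ^ 2 := by rw [hαdef]; field_simp; ring
  have hy1 : 1 ≤ d / ((1 - d) * B) := by
    rw [one_le_div (by positivity)]
    refine (sq_le_sq₀ (by positivity) hδ.le).1 ?_
    have hαpos : 0 < α * (1 - α) := by positivity
    refine le_of_mul_le_mul_right ?_ hαpos
    rw [u] at hy
    calc ((1 - d) * B) ^ 2 * (α * (1 - α)) = (1 - d) ^ 2 * (B ^ 2 * (α * (1 - α))) := by ring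
      _ ≤ _ := by rw [hBsq]; linarith
  have hval := chernoffExponent_conditional (R := R) (t := t) hp0 (by linarith) hδ (by linarith)
    hα0 hα1 hz0 hz hB rfl
  have e1 : d * (2 * α - 1) = 2 * t := by rw [hαdef]; field_simp; ring
  rw [hh, e1, sub_self, zero_add, sub_self, zero_mul, add_zero] at hval
  rw [← hval]
  refine (hC.hasExponent_chernoff hR0 hR1 hp0 (by linarith) hz0 hy1 one_pos).mono fun n => ?_
  have := confusionProb_le (C n).1 (a := 2 * t * n) hp0.le (by linarith : p ≤ 1) hz1
  simpa using this

/-- No constraint but the margin is active, `y = v = 1`. -/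
lemma GoodSpectrum.hasExponent_independent {R : ℝ} (hR0 : 0 ≤ R) (hR1 : R ≤ 1)
    {C : (n : ℕ) → CodeOfRate R n} (hC : GoodSpectrum C) {p t e e' : ℝ} (hp0 : 0 < p)
    (hp : p < 1 / 2) (he0 : 0 < e) (he1 : e < 1) (he0' : 0 < e') (he1' : e' ≤ 1 / 2)
    (ht : e - e' = 2 * t) (hee : (1 - p) * (e * e') = p * ((1 - e) * (1 - e'))) :
    HasExponent (fun n => confusionProb (C n).1 (2 * t * n) p) (D e p + (1 - R - h e')) := by
  have hq : 0 < 1 - p := by linarith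
  have hz1 : 1 ≤ (1 - e') / e' := by rw [one_le_div he0']; linarith
  have hv : 1 = p * (1 - e) * (1 - e') / ((1 - p) * e * e') := by
    rw [eq_div_iff (by positivity)]; linarith
  have hval := chernoffExponent_product (R := R) (δ := δGV R) (t := t) hp0 (by linarith) he0 he1
    he0' (by linarith) rfl hv
  rw [ht, sub_self, zero_mul, add_zero, Real.logb_one, mul_zero, sub_zero] at hval
  rw [← hval]
  refine (hC.hasExponent_chernoff hR0 hR1 hp0 (by linarith) (by linarith) le_rfl one_pos).mono
    fun n => ?_
  have := confusionProb_le (C n).1 (a := 2 * t * n) hp0.le (by linarith : p ≤ 1) hz1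
  simpa using this

/-- The weight limit on the received word is active; `hle` says that `v ≥ 1`. -/
lemma GoodSpectrum.hasExponent_tail {R : ℝ} (hR0 : 0 ≤ R) (hR1 : R ≤ 1)
    {C : (n : ℕ) → CodeOfRate R n} (hC : GoodSpectrum C) {p t : ℝ} (hp0 : 0 < p)
    (hp : p < 1 / 2) (hpe : p ≤ δGV R + 2 * t) (he1 : δGV R + 2 * t < 1)
    (hle : (1 - p) * ((δGV R + 2 * t) * δGV R) ≤
      p * ((1 - (δGV R + 2 * t)) * (1 - δGV R))) :
    HasExponent (fun n => confusionProb (C n).1 (2 * t * n) p) (D (δGV R + 2 * t) p) := by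
  obtain ⟨hδ0, hδ1⟩ := δGV_mem hR0 hR1
  have hh := h_δGV hR0 hR1
  obtain ⟨v', hv', htail⟩ := ErasureDecoding.hasExponent_tail hp0 hpe he1
  have hq : 0 < 1 - p := by linarith
  -- for `δ = 0` the margin alone forces the received word into the tail
  rcases hδ0.eq_or_lt with h0 | hδ
  · refine htail.mono fun n => ?_
    refine confusionProb_le_tail (C n).1 hp0.le (by linarith) hv' (le_of_eq ?_)
    rw [← h0, zero_add]
  · set d := δGV R with hd
    set e := d + 2 * t with he
    have he0 : 0 < e := by linarith
    have hv : 1 ≤ p * (1 - e) * (1 - d) / ((1 - p) * e * d) := by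
      rw [one_le_div (by positivity)]; linarith
    have hz1 : 1 ≤ (1 - d) / d := by rw [one_le_div hδ]; linarith
    have hval := chernoffExponent_product (R := R) (δ := d) (t := t) hp0 (by linarith) he0 he1
      hδ (by linarith) rfl rfl
    rw [hh, ← he, show 2 * t - (e - d) = 0 by rw [he]; ring, sub_self, zero_mul, sub_self,
      zero_mul, add_zero, sub_zero, add_zero] at hval
    have hmain := hC.hasExponent_chernoff (t := t) hR0 hR1 hp0 (by linarith : p < 1)
      (by linarith : 0 < (1 - d) / d) le_rfl
      (by linarith : 0 < p * (1 - e) * (1 - d) / ((1 - p) * e * d))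
    rw [← hd, hval] at hmain
    exact (htail.add hmain).mono fun n =>
      confusionProb_le_tail_add (C n).1 hp0.le (by linarith) hv hv' hz1

/-- The exponent `M` in the form common to both signs, `t = στ`. -/
lemma GoodSpectrum.hasExponent_M {R : ℝ} (hR0 : 0 ≤ R) (hR1 : R ≤ 1)
    {C : (n : ℕ) → CodeOfRate R n} (hC : GoodSpectrum C) {p τ σ : ℝ} (hp0 : 0 < p)
    (hp : p < 1 / 2) (hτ0 : 0 ≤ τ) (hτ : τ < 1 / 2) (hσ : σ = 1 ∨ σ = -1)
    (hω : ω₀ p τ ≤ 1 / 2 ∨ δGV R < 1 - ω₀ p τ) (hρ1 : ρmid p τ - σ * τ ≤ 1 / 2)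
    (hpe : p ≤ δGV R + 2 * (σ * τ)) (he1 : δGV R + 2 * (σ * τ) < 1)
    (hα : p * δGV R ≤ δGV R / 2 + σ * τ) :
    HasExponent (fun n => confusionProb (C n).1 (2 * (σ * τ) * n) p) (M σ R p τ) := by
  have hst : σ * τ = τ ∨ σ * τ = -τ := by rcases hσ with rfl | rfl <;> simp
  have hsq : (σ * τ) ^ 2 = τ ^ 2 := by rcases hst with h | h <;> rw [h]; ring
  have hr0 := lt_ρmid hp0 hp hτ
  have hr1 := ρmid_lt_half hp0 hp hτ0 hτ
  have hquad : (1 - p) * ((ρmid p τ + σ * τ) * (ρmid p τ - σ * τ)) =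
      p * ((1 - (ρmid p τ + σ * τ)) * (1 - (ρmid p τ - σ * τ))) := by
    have := ρmid_quadratic (τ := τ) hp0 hp
    linear_combination this + (2 * p - 1) * hsq
  have hlo : -τ ≤ σ * τ := by rcases hst with h | h <;> rw [h]; linarith
  have hhi : σ * τ ≤ τ := by rcases hst with h | h <;> rw [h]; linarith
  obtain ⟨hδ0, hδ1⟩ := δGV_mem hR0 hR1
  rcases M_cases hR0 hR1 hp0 hp hτ0 hτ hω (by linarith) hρ1 with
    ⟨h1, hM⟩ | ⟨-, -, hM⟩ | ⟨h1, hM⟩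
  · have h2 := two_mul_lt_ω₀ hp0 hp hτ0 hτ
    have hδ : 0 < δGV R := by linarith
    have key := hC.hasExponent_conditional (t := σ * τ) hR0 hR1 hp0 hp hδ
      (by rw [← mul_le_mul_iff_left₀ hδ, add_mul, div_mul_cancel₀ _ hδ.ne']; linarith)
      (by rw [← mul_lt_mul_iff_left₀ hδ, add_mul, div_mul_cancel₀ _ hδ.ne']; linarith)
      (by rw [hsq]; exact le_of_ω₀_le hp0 hp hτ0 hτ h1 hδ1)
    rw [mul_D_half_add hp0 hp hδ hst] at key
    rw [hM]
    convert key using 2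
    ring
  · rw [hM]
    exact hC.hasExponent_independent hR0 hR1 hp0 hp (by linarith) (by linarith) (by linarith) hρ1
      (by ring) hquad
  · rw [hM]
    refine hC.hasExponent_tail hR0 hR1 hp0 hp hpe he1 ?_
    have hq : 0 < 1 - p := by linarith
    have hlt : δGV R + 2 * (σ * τ) ≤ ρmid p τ + σ * τ := by linarith
    calc (1 - p) * ((δGV R + 2 * (σ * τ)) * δGV R)
        ≤ (1 - p) * ((ρmid p τ + σ * τ) * (ρmid p τ - σ * τ)) := by gcongr; linarith
      _ = p * ((1 - (ρmid p τ + σ * τ)) * (1 - (ρmid p τ - σ * τ))) := hquad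
      _ ≤ _ := by gcongr; linarith

/-! ### Comparison with the Blokh–Zyablov bounds -/

lemma ρcrit_spec {p : ℝ} (hp0 : 0 < p) (hp : p < 1 / 2) :
    0 < ρcrit p ∧ ρcrit p < 1 / 2 ∧ (1 - p) * ρcrit p ^ 2 = p * (1 - ρcrit p) ^ 2 := by
  have hq : 0 < 1 - p := by linarith
  have ha : 0 < √p := Real.sqrt_pos.2 hp0
  have hb : 0 < √(1 - p) := Real.sqrt_pos.2 hq
  have hab : √p < √(1 - p) := Real.sqrt_lt_sqrt hp0.le (by linarith)
  refine ⟨by rw [ρcrit]; positivity, ?_, ?_⟩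
  · rw [ρcrit, div_lt_iff₀ (by positivity)]; linarith
  · have e : 1 - ρcrit p = √(1 - p) / (√p + √(1 - p)) := by rw [ρcrit]; field_simp; ring
    rw [e, ρcrit, div_pow, div_pow, Real.sq_sqrt hp0.le, Real.sq_sqrt hq.le]
    ring

/-- `2ρ(1 - ρ)` at `ρ = ρcrit` is the solution `x` of `x = 2√u (1 - x)`. -/
lemma two_mul_sqrt_mul {p : ℝ} (hp0 : 0 < p) (hp : p < 1 / 2) :
    2 * √(p * (1 - p)) * (1 - 2 * ρcrit p * (1 - ρcrit p)) = 2 * ρcrit p * (1 - ρcrit p) := by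
  have hq : 0 < 1 - p := by linarith
  have ha : 0 < √p := Real.sqrt_pos.2 hp0
  have hb : 0 < √(1 - p) := Real.sqrt_pos.2 hq
  have h2 := Real.sq_sqrt hp0.le
  have h3 := Real.sq_sqrt hq.le
  rw [Real.sqrt_mul hp0.le, ρcrit]
  field_simp
  linear_combination √(1 - p) * (h2 + h3)

lemma logb_two_mul_sqrt_u {p : ℝ} (hp0 : 0 < p) (hp : p < 1 / 2) :
    Real.logb 2 (2 * √(p * (1 - p))) = 1 + 1 / 2 * Real.logb 2 (u p) := by
  have hu : 0 < p * (1 - p) := mul_pos hp0 (by linarith)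
  rw [Real.logb_mul (by norm_num) (Real.sqrt_pos.2 hu).ne', Real.logb_self_eq_one one_lt_two, u,
    Real.sqrt_eq_rpow, Real.logb_rpow_eq_mul_logb_of_pos hu]

lemma two_mul_logb_eq_ν {p z : ℝ} (hz : p * z ^ 2 = 1 - p) (hp0 : 0 < p) :
    2 * Real.logb 2 z = ν p := by
  have : (1 - p) / p = z ^ 2 := by rw [← hz]; field_simp
  rw [ν, this, Real.logb_pow]; norm_num

/-- The slope of `D` in terms of the tilting parameters of the independent type `e = e' = d`. -/
lemma deriv_D {p d : ℝ} (hp0 : 0 < p) (hp : p < 1 / 2) (hd0 : 0 < d) (hd1 : d < 1) :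
    deriv (fun x => D x p) d =
      Real.logb 2 ((1 - d) / d) - Real.logb 2 (p * (1 - d) * (1 - d) / ((1 - p) * d * d)) := by
  have hq : 0 < 1 - p := by linarith
  have hd : 0 < 1 - d := by linarith
  have e : (fun x => D x p) = fun x => (x * (Real.logb 2 (1 - p) - Real.logb 2 p)
      - Real.logb 2 (1 - p)) - Real.binEntropy x / Real.log 2 := by
    funext x; rw [D, h_eq_binEntropy, T]; ring
  have h1 : HasDerivAt (fun x => (x * (Real.logb 2 (1 - p) - Real.logb 2 p)
      - Real.logb 2 (1 - p)) - Real.binEntropy x / Real.log 2)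
      ((1 * (Real.logb 2 (1 - p) - Real.logb 2 p)) -
        (Real.log (1 - d) - Real.log d) / Real.log 2) d :=
    (((hasDerivAt_id d).mul_const _).sub_const _).sub
      ((Real.hasDerivAt_binEntropy hd0.ne' hd1.ne).div_const _)
  rw [e, h1.deriv, Real.logb_div hd.ne' hd0.ne', Real.logb_div (by positivity) (by positivity),
    Real.logb_mul (by positivity) hd.ne', Real.logb_mul hp0.ne' hd.ne',
    Real.logb_mul (by positivity) hd0.ne', Real.logb_mul hq.ne' hd0.ne']
  simp only [Real.logb]
  ring

/-- The Blokh–Zyablov bound is the exponent of the Chernoff bound with the tilting parameters that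
are optimal at `τ = 0`. For these, flipped and unflipped bits in the support of a codeword have equal
weight. -/
lemma exists_chernoffExponent_eq_BZ {R p τ σ : ℝ} (hR0 : 0 ≤ R) (hR1 : R ≤ 1) (hp0 : 0 < p)
    (hp : p < 1 / 2) (hδ0 : 0 < δGV R) :
    ∃ z y v : ℝ, 0 < z ∧ 1 ≤ y ∧ 1 ≤ v ∧ (1 - p) * z⁻¹ = p / v * z ∧
      (v = 1 ∨ (y = 1 ∧ (1 - p) * δGV R ^ 2 ≤ p * (1 - δGV R) ^ 2)) ∧
      chernoffExponent p R (δGV R) (σ * τ) z y v = BZ σ R p τ := by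
  have hδ1 := (δGV_mem hR0 hR1).2
  have hδmem := δGV_mem hR0 hR1
  have hh := h_δGV hR0 hR1
  have hq : 0 < 1 - p := by linarith
  obtain ⟨hρ0, hρ1, hρ⟩ := ρcrit_spec hp0 hp
  have hmono : ∀ x ∈ Set.Icc (0 : ℝ) (1 / 2), (R ≤ 1 - h x ↔ x ≤ δGV R) := fun x hx => by
    rw [← h_le_iff hx hδmem, hh]; constructor <;> intro h <;> linarith
  have hc := hmono (ρcrit p) ⟨hρ0.le, hρ1.le⟩
  have hRe : R ≤ Re p ↔ 2 * ρcrit p * (1 - ρcrit p) ≤ δGV R := by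
    refine hmono _ ⟨?_, ?_⟩
    · have : 0 < 1 - ρcrit p := by linarith
      positivity
    · nlinarith [sq_nonneg (1 - 2 * ρcrit p)]
  have hρe : ρcrit p < 2 * ρcrit p * (1 - ρcrit p) := by nlinarith
  set d := δGV R with hd
  by_cases hRc : R < Rc p
  · have hcd : ρcrit p ≤ d := hc.1 hRc.le
    by_cases hRe' : R ≤ Re p
    · -- `α = 1 / 2` in the conditional type
      have hze : (0 : ℝ) < (1 - p) / p := by positivity
      have hz0 : 0 < √((1 - p) / p) := Real.sqrt_pos.2 hze
      have hz2 : p * √((1 - p) / p) ^ 2 = 1 - p := by rw [Real.sq_sqrt hze.le]; field_simp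
      obtain ⟨B, hB⟩ : ∃ B, B = p * √((1 - p) / p) / (1 / 2) := ⟨_, rfl⟩
      have hB0 : 0 < B := by rw [hB]; positivity
      have hz : p * √((1 - p) / p) ^ 2 * (1 - 1 / 2) = 1 / 2 * (1 - p) := by
        rw [hz2]; ring
      have hBsq := conditional_factor_sq (by norm_num) hz hB
      have hBe : B = 2 * √(p * (1 - p)) := by
        rw [show p * (1 - p) = (B / 2) ^ 2 by rw [← hBsq]; ring, Real.sqrt_sq (by positivity)]
        ring
      have hd1 : 0 < 1 - d := by linarith
      refine ⟨√((1 - p) / p), d / ((1 - d) * B), 1, hz0, ?_, le_rfl, ?_, Or.inl rfl, ?_⟩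
      · rw [one_le_div (by positivity)]
        have h1 := hRe.1 hRe'
        have h2 := two_mul_sqrt_mul hp0 hp
        rw [← hBe] at h2
        nlinarith
      · rw [div_one, ← div_eq_mul_inv, div_eq_iff hz0.ne']
        linear_combination -hz2
      · rw [chernoffExponent_conditional hp0 (by linarith) hδ0 (by linarith) (by norm_num)
          (by norm_num) hz0 hz hB rfl, hh, BZ, if_pos hRc, E0, if_pos hRe',
          logb_two_mul_sqrt_u hp0 hp, ← two_mul_logb_eq_ν hz2 hp0]
        have := mul_D_half_add (t := 0) (τ := 0) hp0 hp hδ0 (Or.inl rfl)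
        rw [zero_div, add_zero, h_half] at this
        rw [this]; ring
    · -- the independent type with `e = e' = ρcrit`
      have hz2 : p * ((1 - ρcrit p) / ρcrit p) ^ 2 = 1 - p := by
        field_simp; linarith
      have hz0 : 0 < (1 - ρcrit p) / ρcrit p := div_pos (by linarith) hρ0
      have hρ' : 0 < 1 - ρcrit p := by linarith
      refine ⟨(1 - ρcrit p) / ρcrit p, 1, 1, hz0, le_rfl, le_rfl, ?_, Or.inl rfl, ?_⟩
      · rw [div_one, ← div_eq_mul_inv, div_eq_iff hz0.ne']
        linear_combination -hz2
      · rw [chernoffExponent_product hp0 (by linarith) hρ0 (by linarith) hρ0 (by linarith) rfl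
          (by rw [eq_div_iff (by positivity)]; linarith), BZ, if_pos hRc, E0, if_neg hRe',
          if_pos hRc.le, ← two_mul_logb_eq_ν hz2 hp0, Rc, Real.logb_one]
        ring
  · -- the independent type with `e = e' = δ`
    have hdc : d ≤ ρcrit p := by
      by_contra hlt
      push Not at hlt
      have := h_strictMonoOn ⟨hρ0.le, hρ1.le⟩ hδmem hlt
      rw [hh] at this
      rw [Rc] at hRc
      linarith
    have hle : (1 - p) * d ^ 2 ≤ p * (1 - d) ^ 2 := by
      have h1 : d ^ 2 ≤ ρcrit p ^ 2 := by gcongr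
      have h2 : (1 - ρcrit p) ^ 2 ≤ (1 - d) ^ 2 := by gcongr; linarith
      nlinarith
    have hd1 : 0 < 1 - d := by linarith
    have hE0 : E0 R p = D d p := by
      have hnRe : ¬ R ≤ Re p := fun h => by linarith [hRe.1 h]
      rw [E0, if_neg hnRe]
      split_ifs with h1
      · have e : d = ρcrit p := le_antisymm hdc (hc.1 h1)
        have : R = Rc p := le_antisymm h1 (not_lt.1 hRc)
        rw [e, this]; ring
      · rfl
    refine ⟨(1 - d) / d, 1, p * (1 - d) * (1 - d) / ((1 - p) * d * d), by positivity, le_rfl, ?_,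
      ?_, Or.inr ⟨rfl, hle⟩, ?_⟩
    · rw [one_le_div (by positivity)]; linarith
    · field_simp
    · rw [chernoffExponent_product hp0 (by linarith) hδ0 (by linarith) hδ0 (by linarith) rfl rfl,
        BZ, if_neg hRc, hE0, deriv_D hp0 hp hδ0 (by linarith), hh]
      ring

/-- For `τ > 0` the bound `M` is better than the Blokh–Zyablov bound: it is the value of the
primal problem at a type that the tilting of the Blokh–Zyablov bound does not fit. -/
lemma BZ_lt_M {R p τ σ : ℝ} (hR0 : 0 ≤ R) (hR1 : R ≤ 1) (hp0 : 0 < p)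
    (hp : p < 1 / 2) (hτ0 : 0 < τ) (hτ : τ < 1 / 2) (hσ : σ = 1 ∨ σ = -1)
    (hω : ω₀ p τ ≤ 1 / 2 ∨ δGV R < 1 - ω₀ p τ) (hρ1 : ρmid p τ - σ * τ ≤ 1 / 2)
    (hδ : 0 < δGV R) (he0 : 0 < δGV R + 2 * (σ * τ)) (he1 : δGV R + 2 * (σ * τ) < 1) :
    BZ σ R p τ < M σ R p τ := by
  have hst : σ * τ = τ ∨ σ * τ = -τ := by rcases hσ with rfl | rfl <;> simp
  have hne : σ * τ ≠ 0 := by rcases hst with h | h <;> rw [h] <;> linarith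
  have hsq : (σ * τ) ^ 2 = τ ^ 2 := by rcases hst with h | h <;> rw [h]; ring
  have hr0 := lt_ρmid hp0 hp hτ
  have hr1 := ρmid_lt_half hp0 hp hτ0.le hτ
  have hlo : -τ ≤ σ * τ := by rcases hst with h | h <;> rw [h]; linarith
  have hhi : σ * τ ≤ τ := by rcases hst with h | h <;> rw [h]; linarith
  obtain ⟨-, hδ1⟩ := δGV_mem hR0 hR1
  have hh := h_δGV hR0 hR1
  obtain ⟨z, y, v, hz, hy, hv, hw, hvy, hBZ⟩ :=
    exists_chernoffExponent_eq_BZ (τ := τ) (σ := σ) hR0 hR1 hp0 hp hδ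
  rw [← hBZ]
  have hLy : 0 ≤ Real.logb 2 y := Real.logb_nonneg one_lt_two hy
  have hLv : 0 ≤ Real.logb 2 v := Real.logb_nonneg one_lt_two hv
  have hq : 0 < 1 - p := by linarith
  set d := δGV R with hd
  have hd1 : 0 < 1 - d := by linarith
  -- the terms left by weak duality have the right sign at types with `e - e' = 2στ`
  have product : ∀ e e' : ℝ, 0 < e → e < 1 → 0 < e' → e' < 1 → e - e' = 2 * (σ * τ) →
      d ≤ (1 - e) * e' + e * (1 - e') → e ≤ d + 2 * (σ * τ) →
      chernoffExponent p R d (σ * τ) z y v < D e p + (1 - R - h e') := by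
    intro e e' he0 he1 he0' he1' het hwt hee
    have h1 : 0 < 1 - e := by linarith
    have h2 : 0 < 1 - e' := by linarith
    have key := chernoffExponent_lt (R := R) (δ := d) (t := σ * τ) (y := y) (a := (1 - e) * (1 - e'))
      (b := (1 - e) * e') (c := e * e') (d := e * (1 - e')) hp0 (by linarith) hz (by linarith)
      (by linarith) (by positivity) (by positivity) (by positivity) (by positivity) (by ring) hw
      (fun h => hne (by linarith))
    rw [typeExponent_product he0 he1 he0' he1',
      show 2 * (σ * τ) - (e * (1 - e') - (1 - e) * e') = 0 by rw [← het]; ring,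
      show e * e' + e * (1 - e') = e by ring] at key
    have h3 := mul_nonneg (sub_nonneg.2 hwt) hLy
    have h4 := mul_nonneg (sub_nonneg.2 hee) hLv
    linarith
  rcases M_cases hR0 hR1 hp0 hp hτ0.le hτ hω (by linarith) hρ1 with
    ⟨h1, hM⟩ | ⟨h1, h2, hM⟩ | ⟨h1, hM⟩
  · rw [hM]
    have h2τ := two_mul_lt_ω₀ hp0 hp hτ0.le hτ
    have hle := le_of_ω₀_le hp0 hp hτ0.le hτ h1 hδ1
    have hv1 : v = 1 := by
      refine hvy.resolve_right fun h => ?_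
      have h3 := h.2
      -- `δ ≤ ρcrit` and `ω₀ ≤ δ` are incompatible
      rw [u] at hle
      have h4 : (1 - p) * (p * (1 - d) ^ 2) ≤ (1 - p) * (d ^ 2 / 4) :=
        mul_le_mul_of_nonneg_left (by nlinarith) hq.le
      nlinarith [mul_pos hp0 (pow_pos hd1 2)]
    have hα0 : 0 < 1 / 2 + σ * τ / d := by
      rw [← mul_lt_mul_iff_left₀ hδ, add_mul, div_mul_cancel₀ _ hδ.ne']; linarith
    have hα1 : 1 / 2 + σ * τ / d < 1 := by
      rw [← mul_lt_mul_iff_left₀ hδ, add_mul, div_mul_cancel₀ _ hδ.ne']; linarith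
    have hval := mul_D_half_add hp0 hp hδ hst
    have hdα : d * (1 / 2 + σ * τ / d) = d / 2 + σ * τ := by field_simp
    set α := 1 / 2 + σ * τ / d with hαdef
    have hα1' : 0 < 1 - α := by linarith
    have key := chernoffExponent_lt (R := R) (δ := d) (t := σ * τ) (y := y) (a := (1 - d) * (1 - p))
      (b := d * (1 - α)) (c := (1 - d) * p) (d := d * α) hp0 (by linarith) hz (by linarith)
      (by linarith) (by positivity) (by positivity) (by positivity) (by positivity) (by ring) hw
      (fun h => hne (by linarith))
    rw [typeExponent_conditional hp0 (by linarith) hδ (by linarith) hα0 hα1, hh, hval, hv1,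
      show 2 * (σ * τ) - (d * α - d * (1 - α)) = 0 by linear_combination (-2 : ℝ) * hdα,
      show d - (d * (1 - α) + d * α) = 0 by ring, Real.logb_one] at key
    rw [hv1]
    linarith
  · rw [hM]
    refine product _ _ (by linarith) (by linarith) (by linarith) (by linarith) (by ring) ?_
      (by linarith)
    rw [ω₀_eq hp0 hp] at h1
    linarith
  · rw [hM]
    have := product (d + 2 * (σ * τ)) d he0 he1 hδ (by linarith) (by ring) (by nlinarith) le_rfl
    rw [hh] at this
    linarith

/-! ### The exponents of undetected error and erasure -/

lemma δGV_le_half_sub {R τ : ℝ} (hR0 : 0 ≤ R) (hR1 : R ≤ 1) (hτ0 : 0 ≤ τ) (hτ : τ < 1 / 2)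
    (hR : 1 - h (1 / 2 - τ) ≤ R) : δGV R ≤ 1 / 2 - τ := by
  rw [← h_le_iff (δGV_mem hR0 hR1) ⟨by linarith, by linarith⟩, h_δGV hR0 hR1]
  linarith

lemma GoodSpectrum.Mplus_le {R : ℝ} (hR0 : 0 ≤ R) (hR1 : R ≤ 1)
    {C : (n : ℕ) → CodeOfRate R n} (hC : GoodSpectrum C) {p τ : ℝ} (hp0 : 0 < p)
    (hp : p < 1 / 2) (hτ0 : 0 ≤ τ) (hτ : τ < 1 / 2) (hR : 1 - h (1 / 2 - τ) ≤ R)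
    (hpe : p ≤ δGV R + 2 * τ) :
    (Mplus R p τ : EReal) ≤
      liminf (fun n : ℕ => exponent n (errorProb (C n).1 (τ * n) p)) atTop := by
  have hδ := δGV_le_half_sub hR0 hR1 hτ0 hτ hR
  have hδ0 := (δGV_mem hR0 hR1).1
  have hω := ω₀_lt hp0 hp hτ0 hτ
  have hρ := ρmid_lt_half hp0 hp hτ0 hτ
  refine HasExponent.le_liminf (fun n => errorProb_nonneg _ hp0.le (by linarith)) ?_
  refine (hC.hasExponent_M hR0 hR1 hp0 hp hτ0 hτ (Or.inl rfl) (Or.inr (by linarith))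
    (by linarith) (by linarith) (by linarith) (by nlinarith)).mono fun n => ?_
  refine (errorProb_le_confusionProb _ hp0.le (by linarith)).trans (le_of_eq ?_)
  congr 1; ring

lemma GoodSpectrum.Mminus_le {R : ℝ} (hR0 : 0 ≤ R) (hR1 : R ≤ 1)
    {C : (n : ℕ) → CodeOfRate R n} (hC : GoodSpectrum C) {p τ : ℝ} (hp0 : 0 < p)
    (hp : p < 1 / 2) (hτ0 : 0 ≤ τ) (hτ : τ < 1 / 2) (hpe : p + 2 * τ ≤ δGV R) :
    (Mminus R p τ : EReal) ≤
      liminf (fun n : ℕ => exponent n (erasureProb (C n).1 (τ * n) p)) atTop := by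
  have hδ1 := (δGV_mem hR0 hR1).2
  have hpτ : p + 2 * τ ≤ 1 / 2 := hpe.trans hδ1
  have hρ := ρmid_add_le_half hp0 hp hτ hpτ
  refine HasExponent.le_liminf (fun n => erasureProb_nonneg _ hp0.le (by linarith)) ?_
  refine (hC.hasExponent_M hR0 hR1 hp0 hp hτ0 hτ (Or.inr rfl)
    (Or.inl (ω₀_le_half hp0 hp hτ0 hτ hpτ)) (by linarith) (by linarith) (by linarith)
    ?_).mono fun n => ?_
  · -- `(1/2 - p) δ ≥ (1/2 - p) (p + 2τ) ≥ τ`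
    nlinarith [mul_le_mul_of_nonneg_left hpe (by linarith : 0 ≤ 1 / 2 - p),
      mul_le_mul_of_nonneg_left hpτ hp0.le]
  · refine (erasureProb_le_confusionProb _ hp0.le (by linarith)).trans (le_of_eq ?_)
    congr 1; ring

end ErasureDecoding

open ErasureDecoding in
theorem mainTheorem1 (R p τ : ℝ) (hp0 : 0 < p) (hp : p < 1 / 2) (hτ0 : 0 ≤ τ) (hτ : τ < 1 / 2)
    (hR0 : 0 ≤ R) (hR1 : R ≤ 1) :
    -- the bounds on the best attainable exponents
    (1 - h (1 / 2 - τ) ≤ R → p ≤ δGV R + 2 * τ → (Mplus R p τ : EReal) ≤ Ee R p τ) ∧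
    (τ ≤ p / 2 → p + 2 * τ ≤ δGV R → (Mminus R p τ : EReal) ≤ Ex R p τ) ∧
    -- both are attained by one sequence of linear codes, which meets the Gilbert–Varshamov bound
    (∃ C : (n : ℕ) → CodeOfRate R n,
      (∀ ε : ℝ, 0 < ε → ∀ᶠ n : ℕ in atTop, ∀ c ∈ (C n).1, c ≠ 0 →
        (δGV R - ε) * n ≤ (hammingNorm c : ℝ)) ∧
      (1 - h (1 / 2 - τ) ≤ R → p ≤ δGV R + 2 * τ →
        (Mplus R p τ : EReal) ≤
          liminf (fun n : ℕ => exponent n (errorProb (C n).1 (τ * n) p)) atTop) ∧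
      (τ ≤ p / 2 → p + 2 * τ ≤ δGV R →
        (Mminus R p τ : EReal) ≤
          liminf (fun n : ℕ => exponent n (erasureProb (C n).1 (τ * n) p)) atTop)) ∧
    -- for positive `τ` and rates up to capacity they improve on the Blokh–Zyablov bounds
    (0 < τ → R ≤ 1 - h p →
      (1 - h (1 / 2 - τ) ≤ R → BZ 1 R p τ < Mplus R p τ) ∧
      (τ ≤ p / 2 → p + 2 * τ ≤ δGV R → BZ (-1) R p τ < Mminus R p τ)) := by
  obtain ⟨C, hC⟩ := exists_goodSpectrum hR1
  have hplus := fun h1 h2 => hC.Mplus_le hR0 hR1 hp0 hp hτ0 hτ h1 h2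
  have hminus := fun h2 => hC.Mminus_le hR0 hR1 hp0 hp hτ0 hτ h2
  refine ⟨fun h1 h2 => (hplus h1 h2).trans ?_, fun _ h2 => (hminus h2).trans ?_,
    ⟨C, fun ε hε => hC.weight_ge hR0 hR1 hε, hplus, fun _ => hminus⟩, fun hτp hRp => ?_⟩
  · exact liminf_le_liminf (Eventually.of_forall fun n =>
      le_iSup (fun C : CodeOfRate R n => exponent n (errorProb C.1 (τ * n) p)) (C n))
  · exact liminf_le_liminf (Eventually.of_forall fun n =>
      le_iSup (fun C : CodeOfRate R n => exponent n (erasureProb C.1 (τ * n) p)) (C n))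
  have hδp : p ≤ δGV R := by
    rw [← h_le_iff ⟨hp0.le, hp.le⟩ (δGV_mem hR0 hR1), h_δGV hR0 hR1]
    linarith
  have hδ1 := (δGV_mem hR0 hR1).2
  constructor
  · intro hR
    have hδ := δGV_le_half_sub hR0 hR1 hτ0 hτ hR
    have hω := ω₀_lt hp0 hp hτ0 hτ
    have hρ := ρmid_lt_half hp0 hp hτ0 hτ
    exact BZ_lt_M hR0 hR1 hp0 hp hτp hτ (Or.inl rfl) (Or.inr (by linarith)) (by linarith)
      (by linarith) (by linarith) (by linarith)
  · intro _ hpe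
    have hpτ : p + 2 * τ ≤ 1 / 2 := hpe.trans hδ1
    have hρ := ρmid_add_le_half hp0 hp hτ hpτ
    exact BZ_lt_M hR0 hR1 hp0 hp hτp hτ (Or.inr rfl)
      (Or.inl (ω₀_le_half hp0 hp hτ0 hτ hpτ)) (by linarith) (by linarith) (by linarith)
      (by linarith)
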